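/- Let $\mathbb M=\{\pm e_1,\pm e_2\}\subset\mathbb R^2$, and for $s>0$ put $Q_s=[-s/2,s/2]^2$ and $Q_s^{\mathbb M}=Q_s\times\mathbb M$. A set $\varphi\subset\mathbb R^2\times\mathbb M$ is locally finite if only finitely many of its points lie over each bounded subset of $\mathbb R^2$; $\mathbf N_{\mathbb M}$ is the space of locally finite sets with the $\sigma$-algebra generated by the maps $\varphi\mapsto\#(\varphi\cap B)$, $B$ Borel. Lilypond model. A function $f:\varphi\to[0,\infty]$ is called a growth function of $\varphi$ if (1) $[\xi,\xi+f(x)v)\cap[\eta,\eta+f(y)w)=\emptyset$ for all distinct $x=(\xi,v),y=(\eta,w)\in\varphi$, and (2) for every $x=(\xi,v)\in\varphi$ with $f(x)<\infty$ there is a unique $y=(\eta,w)\in\varphi$ with $\xi+f(x)v\in[\eta,\eta+f(y)w)$ and $|\xi+f(x)v-\eta|<f(x)$. An (infinite) anisotropic descending chain in $\varphi$ is a sequence $(\xi_i)_{i\ge1}$ of locations of points of $\varphi$ such that $|\xi_1-\xi_2|_\infty\le b$ for some $b>0$ and $|\xi_i-\xi_{i+1}|_\infty<|\xi_{i-1}-\xi_i|_\infty$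 for all $i\ge2$. Let $\mathbf N'$ be the family of all non-empty locally finite $\varphi$ that contain no such chain, in which the difference of the locations of two distinct points is never parallel to a coordinate axis or a diagonal (in particular never zero), and whose growth function $f_\varphi$ (unique under these conditions) exists and is finite on $\varphi$. For $\varphi\in\mathbf N'$ and $x=(\xi,v)\in\varphi$ let $I(\varphi,x)=[\xi,\xi+f_\varphi(x)v]$, and put $$\partial^{\mathsf{in},*}_{s}(\varphi)=\{x\in\varphi\setminus Q_s^{\mathbb M}: I(\varphi,x)\cap Q_s\neq\emptyset\}.$$ Let $\lambda>0$ and, for $s>1$, let $X^{(1)}=X^{(1)}(s)$ be an independently and uniformly $\mathbb M$-marked homogeneous Poisson point process on $\mathbb R^2$ with intensity $\lambda(1-s^{-3})$. Lemma (external stabilization). There is a family $(A_s^{(7)})_{s\ge1}$ of measurable subsets of $\mathbf N_{\mathbb M}$ such that $$\lim_{s\to\infty}\mathbb P\big(X^{(1)}(s)\cap Q_{3s}^{\mathbb M}\in A^{(7)}_s\big)=1$$ and such that for every $s\ge1$ and every $\varphi\in\mathbf N'$ with $\varphi\cap Q_{3s}^{\mathbb M}\in A_s^{(7)}$ one has $$\partial^{\mathsf{in},*}_{s}(\varphi)=\partial^{\mathsf{in},*}_{s}(\varphi\cup\psi)$$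 for every locally finite $\psi\subset(\mathbb R^2\times\mathbb M)\setminus Q_{3s}^{\mathbb M}$ with $\varphi\cup\psi\in\mathbf N'$. -/

import Mathlib

open Set Filter Topology MeasureTheory ProbabilityTheory
open scoped ENNReal NNReal

/-! ### The anisotropic line-segment lilypond model in the plane

The plane is `ℝ × ℝ`; its norm is the sup norm `|·|_∞`. All Euclidean lengths that occur below are
lengths of axis-parallel segments, for which the two norms agree. -/

namespace Lilypond

/-- The mark space `{e₁, e₂, -e₁, -e₂}`, indexed by `0, 1, 2, 3`. -/
abbrev Mark : Type := Fin 4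

/-- The growth direction that a mark stands for. -/
def dir : Mark → ℝ × ℝ := ![(1, 0), (0, 1), (-1, 0), (0, -1)]

/-- Marked points of the plane. -/
abbrev MPoint : Type := (ℝ × ℝ) × Mark

/-- The closed square `Q_s(o) = [-s/2, s/2]²`. -/
def box (s : ℝ) : Set (ℝ × ℝ) := Icc (-(s / 2)) (s / 2) ×ˢ Icc (-(s / 2)) (s / 2)

/-- The marked square `Q_s(o) × Mark`. -/
def markedBox (s : ℝ) : Set MPoint := box s ×ˢ (univ : Set Mark)

/-- Finitely many points over every bounded region of the plane. -/
def LocallyFinite (φ : Set MPoint) : Prop :=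
  ∀ K : Set (ℝ × ℝ), Bornology.IsBounded K → {x | x ∈ φ ∧ x.1 ∈ K}.Finite

/-- An infinite `b`-bounded anisotropic descending chain of locations. -/
structure IsDescendingChain (b : ℝ) (ξ : ℕ → ℝ × ℝ) : Prop where
  bounded : ‖ξ 0 - ξ 1‖ ≤ b
  decreasing : ∀ i, ‖ξ (i + 1) - ξ (i + 2)‖ < ‖ξ i - ξ (i + 1)‖

/-- No infinite anisotropic descending chain can be formed from the locations of `φ`. -/
def NoDescendingChain (φ : Set MPoint) : Prop :=
  ¬ ∃ b > 0, ∃ ξ : ℕ → ℝ × ℝ, (∀ i, ξ i ∈ Prod.fst '' φ) ∧ IsDescendingChain b ξ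

/-- Differences of locations of distinct points are parallel neither to a coordinate axis nor to
a diagonal. -/
def Generic (φ : Set MPoint) : Prop :=
  ∀ x ∈ φ, ∀ y ∈ φ, x ≠ y →
    x.1.1 ≠ y.1.1 ∧ x.1.2 ≠ y.1.2 ∧ |x.1.1 - y.1.1| ≠ |x.1.2 - y.1.2|

/-- The half-open segment `[ξ, ξ + r v)` for `x = (ξ, v)`; the ray if `r = ∞`. -/
def halfOpenSegment (x : MPoint) (r : ℝ≥0∞) : Set (ℝ × ℝ) :=
  {p | ∃ t : ℝ, 0 ≤ t ∧ ENNReal.ofReal t < r ∧ p = x.1 + t • dir x.2}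

/-- The point reached from `x = (ξ, v)` after growing by the length `r < ∞`. -/
noncomputable def endPoint (x : MPoint) (r : ℝ≥0∞) : ℝ × ℝ := x.1 + r.toReal • dir x.2

/-- `f` assigns to every point of `φ` the length at which its segment stops growing:
segments are disjoint, and a segment of finite length ends on the segment of a unique stopping
neighbor, which has reached the end point earlier. -/
structure IsGrowthFunction (φ : Set MPoint) (f : MPoint → ℝ≥0∞) : Prop where
  hardCore : ∀ x ∈ φ, ∀ y ∈ φ, x ≠ y →
    halfOpenSegment x (f x) ∩ halfOpenSegment y (f y) = ∅
  stopping : ∀ x ∈ φ, f x < ∞ → ∃! y, y ∈ φ ∧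
    endPoint x (f x) ∈ halfOpenSegment y (f y) ∧ ‖endPoint x (f x) - y.1‖ < (f x).toReal

open Classical in
/-- The growth function of the lilypond model on `φ` (`∞` everywhere if there is none); see
`IsGrowthFunction.eq_growth` for its uniqueness and `Admissible.isGrowthFunction` for its existence. -/
noncomputable def growth (φ : Set MPoint) : MPoint → ℝ≥0∞ :=
  if h : ∃ f, IsGrowthFunction φ f then h.choose else fun _ => ∞

/-- The class `N'` of configurations on which the lilypond model is defined and in which every
segment stops growing after a finite length. -/
structure Admissible (φ : Set MPoint) : Prop where
  nonempty : φ.Nonempty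
  locallyFinite : LocallyFinite φ
  noChain : NoDescendingChain φ
  generic : Generic φ
  growth_lt_top : ∀ x ∈ φ, growth φ x < ∞

/-- The geometric descendant of `x`: the end point of its segment. -/
noncomputable def geomDesc (φ : Set MPoint) (x : MPoint) : ℝ × ℝ := endPoint x (growth φ x)

/-- The closed segment `I(φ, x)` that is grown by `x` in the lilypond model on `φ`. -/
noncomputable def grownSegment (φ : Set MPoint) (x : MPoint) : Set (ℝ × ℝ) :=
  segment ℝ x.1 (geomDesc φ x)

/-- The points of `φ` outside the marked square of side length `s` whose segment intersects the
square. -/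
noncomputable def entering (s : ℝ) (φ : Set MPoint) : Set MPoint :=
  {x | x ∈ φ \ markedBox s ∧ (grownSegment φ x ∩ box s).Nonempty}

/-! ### Well-definedness of the growth function -/

theorem exists_stopping_step {φ : Set MPoint} (hgen : Generic φ) {f g : MPoint → ℝ≥0∞}
    (hf : IsGrowthFunction φ f) (hg : IsGrowthFunction φ g) {x : MPoint} (hx : x ∈ φ)
    (hlt : f x < g x) :
    ∃ y ∈ φ, ‖x.1 - y.1‖ = (f x).toReal ∧ g y < f y ∧ g y < f x := by
  have hfin : f x < ∞ := lt_of_lt_of_le hlt le_top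
  obtain ⟨y, ⟨hy, hhit, hlen⟩, -⟩ := hf.stopping x hx hfin
  obtain ⟨t, ht0, htf, hteq⟩ := hhit
  set a := (f x).toReal with ha
  have ha0 : 0 ≤ a := ENNReal.toReal_nonneg
  have hofa : ENNReal.ofReal a = f x := ENNReal.ofReal_toReal hfin.ne
  have hnd : ∀ m : Mark, ‖dir m‖ = 1 := by
    intro m; fin_cases m <;> simp [dir, Prod.norm_def]
  have hta : t < a := by
    rw [hteq] at hlen
    simpa [norm_smul, hnd, abs_of_nonneg ht0] using hlen
  have hxy : x ≠ y := by
    rintro rfl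
    have h1 : a • dir x.2 = t • dir x.2 := by
      have := hteq
      simpa [endPoint, ← ha] using this
    have h2 : (a - t) • dir x.2 = 0 := by rw [sub_smul, h1, sub_self]
    rcases smul_eq_zero.1 h2 with h | h
    · linarith
    · have := hnd x.2
      rw [h] at this; simp at this
  have hgy : g y ≤ ENNReal.ofReal t := by
    by_contra hcon
    have hmem : endPoint x (f x) ∈
        halfOpenSegment x (g x) ∩ halfOpenSegment y (g y) :=
      ⟨⟨a, ha0, by rw [hofa]; exact hlt, rfl⟩, ⟨t, ht0, not_le.1 hcon, hteq⟩⟩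
    rw [hg.hardCore x hx y hy hxy] at hmem
    exact hmem
  refine ⟨y, hy, ?_, lt_of_le_of_lt hgy htf, lt_of_le_of_lt hgy ?_⟩
  · obtain ⟨h1, h2, -⟩ := hgen x hx y hy hxy
    obtain ⟨⟨x1, x2⟩, m⟩ := x
    obtain ⟨⟨y1, y2⟩, n⟩ := y
    simp only [endPoint, ← ha, Prod.ext_iff, Prod.fst_add, Prod.snd_add, Prod.smul_fst,
      Prod.smul_snd, smul_eq_mul] at hteq
    simp only [Prod.norm_def, Prod.fst_sub, Prod.snd_sub, Real.norm_eq_abs]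
    simp only [ne_eq] at h1 h2
    have key : (|x1 - y1| = a ∧ |x2 - y2| = t) ∨ (|x1 - y1| = t ∧ |x2 - y2| = a) := by
      obtain ⟨e1, e2⟩ := hteq
      fin_cases m <;> fin_cases n <;> simp [dir] at e1 e2 <;>
        first
        | exact absurd (by linarith) h1
        | exact absurd (by linarith) h2
        | (left
           constructor
           · rw [abs_eq ha0]
             first
             | (left; linarith)
             | (right; linarith)
           · rw [abs_eq ht0]
             first
             | (left; linarith)
             | (right; linarith))
        | (right
           constructor
           · rw [abs_eq ht0]
             first
             | (left; linarith)
             | (right; linarith)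
           · rw [abs_eq ha0]
             first
             | (left; linarith)
             | (right; linarith))
    rcases key with ⟨k1, k2⟩ | ⟨k1, k2⟩
    · rw [k1, k2]; exact max_eq_left hta.le
    · rw [k1, k2]; exact max_eq_right hta.le
  · rw [← hofa]
    exact (ENNReal.ofReal_lt_ofReal_iff (lt_of_le_of_lt ht0 hta)).2 hta

/-- On generic configurations without descending chains there is at most one growth function. -/
theorem IsGrowthFunction.eqOn {φ : Set MPoint} (hgen : Generic φ) (hch : NoDescendingChain φ)
    {f g : MPoint → ℝ≥0∞} (hf : IsGrowthFunction φ f) (hg : IsGrowthFunction φ g) :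
    EqOn f g φ := by
  by_contra hne
  obtain ⟨x₀, hx₀, hx₀ne⟩ : ∃ x ∈ φ, f x ≠ g x := by
    simpa [EqOn] using hne
  have step : ∀ x : {x // x ∈ φ ∧ f x ≠ g x}, ∃ y : {x // x ∈ φ ∧ f x ≠ g x},
      ‖x.1.1 - y.1.1‖ = (min (f x.1) (g x.1)).toReal ∧
      min (f y.1) (g y.1) < min (f x.1) (g x.1) := by
    rintro ⟨x, hx, hxne⟩
    rcases lt_or_gt_of_ne hxne with h | h
    · obtain ⟨y, hy, h1, h2, h3⟩ := exists_stopping_step hgen hf hg hx h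
      refine ⟨⟨y, hy, h2.ne'⟩, ?_, ?_⟩
      · simpa [min_eq_left h.le] using h1
      · simpa [min_eq_left h.le, min_eq_right h2.le] using h3
    · obtain ⟨y, hy, h1, h2, h3⟩ := exists_stopping_step hgen hg hf hx h
      refine ⟨⟨y, hy, h2.ne⟩, ?_, ?_⟩
      · simpa [min_eq_right h.le] using h1
      · simpa [min_eq_right h.le, min_eq_left h2.le] using h3
  choose next hdist hdec using step
  let u : ℕ → {x // x ∈ φ ∧ f x ≠ g x} := fun n => next^[n] ⟨x₀, hx₀, hx₀ne⟩
  have hu : ∀ n, u (n + 1) = next (u n) := fun n => Function.iterate_succ_apply' _ _ _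
  refine hch ⟨‖(u 0).1.1 - (u 1).1.1‖ + 1, by positivity, fun n => (u n).1.1,
    fun n => ⟨(u n).1, (u n).2.1, rfl⟩, by simp, fun n => ?_⟩
  have e1 := hdist (u n)
  have e2 := hdist (u (n + 1))
  rw [← hu] at e1 e2
  rw [e1, e2]
  have hlt := hdec (u n)
  rw [← hu] at hlt
  refine (ENNReal.toReal_lt_toReal hlt.ne_top ?_).2 hlt
  have := (u n).2.2
  intro htop
  rw [min_eq_top] at htop
  exact this (htop.1.trans htop.2.symm)

theorem isGrowthFunction_growth {φ : Set MPoint} (h : ∃ f, IsGrowthFunction φ f) :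
    IsGrowthFunction φ (growth φ) := by
  rw [growth, dif_pos h]
  exact h.choose_spec

theorem Admissible.isGrowthFunction {φ : Set MPoint} (h : Admissible φ) :
    IsGrowthFunction φ (growth φ) := by
  by_cases hex : ∃ f, IsGrowthFunction φ f
  · exact isGrowthFunction_growth hex
  · obtain ⟨x, hx⟩ := h.nonempty
    have := h.growth_lt_top x hx
    rw [growth, dif_neg hex] at this
    exact absurd this (lt_irrefl _)

theorem IsGrowthFunction.eq_growth {φ : Set MPoint} (hgen : Generic φ)
    (hch : NoDescendingChain φ) {f : MPoint → ℝ≥0∞} (hf : IsGrowthFunction φ f) :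
    EqOn (growth φ) f φ :=
  (isGrowthFunction_growth ⟨f, hf⟩).eqOn hgen hch hf

/-! ### Marked point configurations and Poisson processes -/

/-- The space of locally finite marked configurations. -/
abbrev Config : Type := {φ : Set MPoint // LocallyFinite φ}

/-- The number of points of `φ` in `B`. -/
noncomputable def Config.count (B : Set MPoint) (φ : Config) : ℕ∞ := (φ.1 ∩ B).encard

/-- The restriction of `φ` to `B`. -/
def Config.restrict (φ : Config) (B : Set MPoint) : Config :=
  ⟨φ.1 ∩ B, fun K hK => (φ.2 K hK).subset fun _ hx => ⟨hx.1.1, hx.2⟩⟩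

/-- The sigma-algebra generated by the counting maps of Borel sets. -/
noncomputable instance instMeasurableSpaceConfig : MeasurableSpace Config :=
  ⨆ B : {B : Set MPoint // MeasurableSet B}, MeasurableSpace.comap (Config.count B.1) ⊤

/-- The intensity measure of an independently and uniformly marked homogeneous process with
`γ` points per unit area: `γ` times Lebesgue measure times the uniform distribution of marks. -/
noncomputable def markedIntensity (γ : ℝ) : Measure MPoint :=
  ENNReal.ofReal γ • (volume : Measure (ℝ × ℝ)).prod (uniformOn (univ : Set Mark))

/-- `X` is a Poisson process with intensity measure `Λ` under the probability measure `P`. -/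
structure IsPoissonProcess {Ω : Type*} [MeasurableSpace Ω] (P : Measure Ω)
    (Λ : Measure MPoint) (X : Ω → Config) : Prop where
  measurable : Measurable X
  count_law : ∀ B : Set MPoint, MeasurableSet B → Λ B < ∞ →
    HasLaw (fun ω => Config.count B (X ω))
      ((poissonMeasure (Λ B).toNNReal).map (fun n : ℕ => (n : ℕ∞))) P
  indep : ∀ (n : ℕ) (B : Fin n → Set MPoint), (∀ i, MeasurableSet (B i)) →
    Pairwise (fun i j => Disjoint (B i) (B j)) →
    iIndepFun (fun i ω => Config.count (B i) (X ω)) P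

end Lilypond

namespace Lilypond

/-! ### Deterministic properties of growth functions -/

/-! Two mechanisms make the influence of far points negligible: segments are short, and differences
between two configurations travel only along descending chains, which are unlikely to be long.

Short segments. A shield is a point alone in a window of side 7, sitting in the central unit square.
By genericity a segment's length equals the sup-distance to its stopping neighbor, so a shield grows
by at least 3 and forms a wall across a strip of width 2. If every run of `K` windows contains a
wall orthogonal to the run, no segment grows by more than `b = 7 * K + 1` beyond a point of the
inner region (`Shielded.growth_le`). Hence every segment entering `box s` starts at sup-norm at most
`s`, and it remains to see that lengths there do not change.

Chains. Suppose `φ` and `φ'` agree on the square of side `3 * s` but give different lengths to some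
`x`. The neighbor that stops the shorter segment also has two different lengths, with a smaller
minimum, and its distance to `x` is the minimum at `x`. Iterating gives a chain with strictly
decreasing steps, all at most `b` (`exists_chain`). Cut `[0, b]` into levels of width `1 / D`. After
`(b * D + 1) * m` steps, pigeonhole yields `m` consecutive steps in one level
(`hasLevelChain_of_growth_ne`). Given one point of such a chain, the next lies in a thin square
annulus of area `O(b / D)`. With `D = C * K` and `C` large compared with `lam`, the expected number
of points there is small, so chains with `m = K` are exponentially unlikely in `K`.

Discretization. To use only void probabilities and independence of counts, the chain is projected to
a grid of mesh `1 / (w * D)`. With high probability no cell holds two points, so the chain becomes a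
self-avoiding path of occupied cells (`not_hasLevelChain`), and a union bound over paths applies
(`IsPoissonProcess.measure_notMem_noPathEvent_le`).

Scales. `K` is about `s ^ (1 / 5)`: a full chain travels `O(C * K ^ 4)`, which is below `s / 4`,
while the polynomially many windows and cells are beaten by factors exponential in `K`. The choice
`w = K ^ 6` makes the grid fine enough to separate points. -/

theorem norm_dir (m : Mark) : ‖dir m‖ = 1 := by
  fin_cases m <;> simp [dir, Prod.norm_def]

theorem mem_box_iff {s : ℝ} {p : ℝ × ℝ} : p ∈ box s ↔ ‖p‖ ≤ s / 2 := by
  simp only [box, mem_prod, mem_Icc, Prod.norm_def, sup_le_iff, Real.norm_eq_abs, abs_le]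

/-- A segment of finite length ends on the segment of another point, at a sup-distance from that
point's location which equals the length. -/
theorem IsGrowthFunction.exists_stopping_neighbor {φ : Set MPoint} (hgen : Generic φ)
    {f : MPoint → ℝ≥0∞} (hf : IsGrowthFunction φ f) {x : MPoint} (hx : x ∈ φ) (hfin : f x < ∞) :
    ∃ y ∈ φ, x ≠ y ∧ ∃ t : ℝ, 0 ≤ t ∧ ENNReal.ofReal t < f y ∧ ENNReal.ofReal t < f x ∧
      endPoint x (f x) = y.1 + t • dir y.2 ∧ ‖x.1 - y.1‖ = (f x).toReal := by
  obtain ⟨y, ⟨hy, hhit, hlen⟩, -⟩ := hf.stopping x hx hfin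
  obtain ⟨t, ht0, htf, hteq⟩ := hhit
  set a := (f x).toReal with ha
  have ha0 : 0 ≤ a := ENNReal.toReal_nonneg
  have hofa : ENNReal.ofReal a = f x := ENNReal.ofReal_toReal hfin.ne
  have hta : t < a := by
    rw [hteq] at hlen
    simpa [norm_smul, norm_dir, abs_of_nonneg ht0] using hlen
  have hxy : x ≠ y := by
    rintro rfl
    have h1 : a • dir x.2 = t • dir x.2 := by
      have := hteq
      simpa [endPoint, ← ha] using this
    have h2 : (a - t) • dir x.2 = 0 := by rw [sub_smul, h1, sub_self]
    rcases smul_eq_zero.1 h2 with h | h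
    · linarith
    · have := norm_dir x.2
      rw [h] at this; simp at this
  refine ⟨y, hy, hxy, t, ht0, htf, ?_, hteq, ?_⟩
  · rw [← hofa]
    exact (ENNReal.ofReal_lt_ofReal_iff (lt_of_le_of_lt ht0 hta)).2 hta
  · obtain ⟨h1, h2, -⟩ := hgen x hx y hy hxy
    obtain ⟨⟨x1, x2⟩, m⟩ := x
    obtain ⟨⟨y1, y2⟩, n⟩ := y
    simp only [endPoint, ← ha, Prod.ext_iff, Prod.fst_add, Prod.snd_add, Prod.smul_fst,
      Prod.smul_snd, smul_eq_mul] at hteq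
    simp only [Prod.norm_def, Prod.fst_sub, Prod.snd_sub, Real.norm_eq_abs]
    simp only [ne_eq] at h1 h2
    -- Parallel marks would force a common coordinate, which genericity excludes. For orthogonal
    -- marks one coordinate difference is `a` and the other is `t < a`.
    have key : (|x1 - y1| = a ∧ |x2 - y2| = t) ∨ (|x1 - y1| = t ∧ |x2 - y2| = a) := by
      obtain ⟨e1, e2⟩ := hteq
      fin_cases m <;> fin_cases n <;> simp [dir] at e1 e2 <;>
        first
        | exact absurd (by linarith) h1
        | exact absurd (by linarith) h2
        | (left
           constructor
           · rw [abs_eq ha0]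
             first
             | (left; linarith)
             | (right; linarith)
           · rw [abs_eq ht0]
             first
             | (left; linarith)
             | (right; linarith))
        | (right
           constructor
           · rw [abs_eq ht0]
             first
             | (left; linarith)
             | (right; linarith)
           · rw [abs_eq ha0]
             first
             | (left; linarith)
             | (right; linarith))
    rcases key with ⟨k1, k2⟩ | ⟨k1, k2⟩
    · rw [k1, k2]; exact max_eq_left hta.le
    · rw [k1, k2]; exact max_eq_right hta.le

/-- The blocking principle, a consequence of the hard-core condition alone: it does not matter which
segment arrives first. It serves both for shields and for comparing two configurations. -/
theorem IsGrowthFunction.le_of_mem_halfOpenSegment {φ : Set MPoint} {f : MPoint → ℝ≥0∞}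
    (hf : IsGrowthFunction φ f) {x y : MPoint} (hx : x ∈ φ) (hy : y ∈ φ) (hxy : x ≠ y) {t : ℝ}
    (ht : 0 ≤ t) (h : x.1 + t • dir x.2 ∈ halfOpenSegment y (f y)) : f x ≤ ENNReal.ofReal t := by
  by_contra hcon
  have hmem : x.1 + t • dir x.2 ∈ halfOpenSegment x (f x) ∩ halfOpenSegment y (f y) :=
    ⟨⟨t, ht, not_le.1 hcon, rfl⟩, h⟩
  rw [hf.hardCore x hx y hy hxy] at hmem
  exact hmem

/-- If two configurations give different lengths to `x`, then the point that stops the shorter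
segment has different lengths too, with a smaller minimum. -/
theorem exists_stopping_step_of_two {φ φ' : Set MPoint} (hgen : Generic φ) {f g : MPoint → ℝ≥0∞}
    (hf : IsGrowthFunction φ f) (hg : IsGrowthFunction φ' g) {x : MPoint} (hx : x ∈ φ)
    (hx' : x ∈ φ') (hlt : f x < g x) :
    ∃ y ∈ φ, ‖x.1 - y.1‖ = (f x).toReal ∧ (y ∈ φ' → g y < f y ∧ g y < f x) := by
  have hfin : f x < ∞ := lt_of_lt_of_le hlt le_top
  obtain ⟨y, hy, hxy, t, ht0, hty, htx, heq, hdist⟩ := hf.exists_stopping_neighbor hgen hx hfin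
  refine ⟨y, hy, hdist, fun hy' => ?_⟩
  -- Under `g` the segment of `x` passes beyond its old end point, so it now blocks `y` at that
  -- point.
  have hgy : g y ≤ ENNReal.ofReal t := by
    refine hg.le_of_mem_halfOpenSegment hy' hx' hxy.symm ht0 ?_
    rw [← heq]
    exact ⟨(f x).toReal, ENNReal.toReal_nonneg, by rwa [ENNReal.ofReal_toReal hfin.ne], rfl⟩
  exact ⟨hgy.trans_lt hty, hgy.trans_lt htx⟩

/-- The segment of a point is at least as long as the distance to all other points. -/
theorem IsGrowthFunction.le_of_isolated {φ : Set MPoint} (hgen : Generic φ) {f : MPoint → ℝ≥0∞}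
    (hf : IsGrowthFunction φ f) {y : MPoint} (hy : y ∈ φ) {r : ℝ}
    (hr : ∀ x ∈ φ, x ≠ y → r ≤ ‖y.1 - x.1‖) : ENNReal.ofReal r ≤ f y := by
  by_contra hcon
  rw [not_le] at hcon
  have hfin : f y < ∞ := lt_of_lt_of_le hcon le_top
  obtain ⟨x, hx, hxy, -, -, -, -, -, hdist⟩ := hf.exists_stopping_neighbor hgen hy hfin
  have h := hr x hx hxy.symm
  rw [hdist] at h
  have := ENNReal.ofReal_le_ofReal h
  rw [ENNReal.ofReal_toReal hfin.ne] at this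
  exact absurd hcon (not_lt.2 this)

/-! ### Shields -/

/-- The unit square with lower left corner `z`. -/
def core (z : ℤ × ℤ) : Set (ℝ × ℝ) :=
  Ico (z.1 : ℝ) (z.1 + 1) ×ˢ Ico (z.2 : ℝ) (z.2 + 1)

/-- The square of side length `7` around `core z`. -/
def window (z : ℤ × ℤ) : Set (ℝ × ℝ) :=
  Ico (z.1 - 3 : ℝ) (z.1 + 4) ×ˢ Ico (z.2 - 3 : ℝ) (z.2 + 4)

/-- There is exactly one point in the window at `z`; it has mark `m` and lies in the core. -/
def IsShield (φ : Set MPoint) (m : Mark) (z : ℤ × ℤ) : Prop :=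
  ∃ y ∈ φ, y.2 = m ∧ y.1 ∈ core z ∧ ∀ x ∈ φ, x.1 ∈ window z → x = y

/-- In every row and in every column, all runs of `K` adjacent windows in the square of side
length `3 * s` contain a shield that is orthogonal to the run. -/
def Shielded (s : ℝ) (K : ℕ) (φ : Set MPoint) : Prop :=
  ∀ z : ℤ × ℤ, 7 * K + 8 + |(z.1 : ℝ)| ≤ 3 * s / 2 → 7 * K + 8 + |(z.2 : ℝ)| ≤ 3 * s / 2 →
    (∃ j < K, IsShield φ 1 (z.1 + 7 * (j : ℕ), z.2)) ∧
      ∃ j < K, IsShield φ 0 (z.1, z.2 + 7 * (j : ℕ))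

/-- The window leaves a margin of 3 on each side of the core, so every other point is at
sup-distance at least 3. -/
theorem IsShield.le_growth {φ : Set MPoint} (hgen : Generic φ) {f : MPoint → ℝ≥0∞}
    (hf : IsGrowthFunction φ f) {m : Mark} {z : ℤ × ℤ} (h : IsShield φ m z) :
    ∃ y ∈ φ, y.2 = m ∧ y.1 ∈ core z ∧ 3 ≤ f y := by
  obtain ⟨y, hy, hm, hc, huniq⟩ := h
  refine ⟨y, hy, hm, hc, ?_⟩
  have := hf.le_of_isolated hgen hy (r := 3) fun x hx hxy => ?_
  · simpa using this
  by_contra hcon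
  refine hxy (huniq x hx ?_)
  simp only [not_le, Prod.norm_def, sup_lt_iff, Real.norm_eq_abs, abs_lt, Prod.fst_sub,
    Prod.snd_sub] at hcon
  obtain ⟨⟨c1, c2⟩, c3, c4⟩ := hc
  obtain ⟨⟨d1, d2⟩, d3, d4⟩ := hcon
  refine ⟨⟨?_, ?_⟩, ?_, ?_⟩ <;> linarith

/-- The shield starts at an unknown height in `[z.2, z.2 + 1)` and grows upwards by at least 3. The
heights in `[z.2 + 1, z.2 + 3)` are covered in every case. -/
theorem IsShield.vertical {φ : Set MPoint} (hgen : Generic φ) {f : MPoint → ℝ≥0∞}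
    (hf : IsGrowthFunction φ f) {z : ℤ × ℤ} (h : IsShield φ 1 z) :
    ∃ y ∈ φ, y.2 = 1 ∧ (z.1 : ℝ) ≤ y.1.1 ∧ y.1.1 < z.1 + 1 ∧
      ∀ u : ℝ, z.2 + 1 ≤ u → u < z.2 + 3 → (y.1.1, u) ∈ halfOpenSegment y (f y) := by
  obtain ⟨y, hy, hm, ⟨⟨c1, c2⟩, c3, c4⟩, h3⟩ := h.le_growth hgen hf
  refine ⟨y, hy, hm, c1, c2, fun u hu1 hu2 => ⟨u - y.1.2, by linarith, ?_, ?_⟩⟩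
  · refine lt_of_lt_of_le ?_ h3
    rw [show (3 : ℝ≥0∞) = ENNReal.ofReal 3 by simp]
    exact (ENNReal.ofReal_lt_ofReal_iff (by norm_num)).2 (by linarith)
  · rw [hm]; ext <;> simp [dir]

theorem IsShield.horizontal {φ : Set MPoint} (hgen : Generic φ) {f : MPoint → ℝ≥0∞}
    (hf : IsGrowthFunction φ f) {z : ℤ × ℤ} (h : IsShield φ 0 z) :
    ∃ y ∈ φ, y.2 = 0 ∧ (z.2 : ℝ) ≤ y.1.2 ∧ y.1.2 < z.2 + 1 ∧
      ∀ u : ℝ, z.1 + 1 ≤ u → u < z.1 + 3 → (u, y.1.2) ∈ halfOpenSegment y (f y) := by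
  obtain ⟨y, hy, hm, ⟨⟨c1, c2⟩, c3, c4⟩, h3⟩ := h.le_growth hgen hf
  refine ⟨y, hy, hm, c3, c4, fun u hu1 hu2 => ⟨u - y.1.1, by linarith, ?_, ?_⟩⟩
  · refine lt_of_lt_of_le ?_ h3
    rw [show (3 : ℝ≥0∞) = ENNReal.ofReal 3 by simp]
    exact (ENNReal.ofReal_lt_ofReal_iff (by norm_num)).2 (by linarith)
  · rw [hm]; ext <;> simp [dir]

/-- The interval of length `7 * K + 1` on either side of a real number contains a run. -/
theorem exists_run (K : ℕ) (a : ℝ) :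
    (∃ k : ℤ, a ≤ k ∧ k + 7 * (K : ℝ) ≤ a + (7 * K + 1)) ∧
      ∃ k : ℤ, a - (7 * K + 1) ≤ k ∧ k + 7 * (K : ℝ) ≤ a := by
  refine ⟨⟨⌈a⌉, Int.le_ceil a, by linarith [(Int.ceil_lt_add_one a).le]⟩,
    ⟨⌊a⌋ - 7 * K, ?_, ?_⟩⟩
  · push_cast; linarith [(Int.sub_one_lt_floor a).le]
  · push_cast; linarith [Int.floor_le a]

/-- A segment cannot grow by more than `7 * K + 1` inside of a shielded square. -/
theorem Shielded.growth_le {φ : Set MPoint} (hgen : Generic φ) {f : MPoint → ℝ≥0∞}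
    (hf : IsGrowthFunction φ f) {s : ℝ} {K : ℕ} (h : Shielded s K φ) (hs : 14 * K + 11 ≤ s / 4)
    {x : MPoint} (hx : x ∈ φ) {t : ℝ} (ht : 0 ≤ t) (hbox : ‖x.1 + t • dir x.2‖ ≤ 5 * s / 4) :
    f x ≤ ENNReal.ofReal (t + (7 * K + 1)) := by
  obtain ⟨⟨x1, x2⟩, m⟩ := x
  simp only [Prod.norm_def, sup_le_iff, Real.norm_eq_abs, abs_le] at hbox
  have hK : (0 : ℝ) ≤ K := K.cast_nonneg
  have hjK : ∀ j < K, (j : ℝ) + 1 ≤ K := fun j hj => by exact_mod_cast hj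
  have hj0 : ∀ j : ℕ, (0 : ℝ) ≤ j := fun j => j.cast_nonneg
  -- Selects the row of windows whose walls are certain to cross the line of growth.
  have hrow : ∀ u : ℝ, ∃ k : ℤ, (k : ℝ) + 1 ≤ u ∧ u < k + 3 ∧ u - 2 ≤ k := fun u =>
    ⟨⌊u⌋ - 1, by push_cast; linarith [Int.floor_le u],
      by push_cast; linarith [Int.lt_floor_add_one u],
      by push_cast; linarith [Int.lt_floor_add_one u]⟩
  have hne : ∀ {y : MPoint} {n n' : Mark}, n ≠ n' → y.2 = n' → ((x1, x2), n) ≠ y := by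
    rintro y n n' hnn rfl rfl
    exact hnn rfl
  have fin : ∀ {y : MPoint} {r : ℝ}, y ∈ φ → ((x1, x2), m) ≠ y → 0 ≤ r →
      r ≤ t + (7 * K + 1) → (x1, x2) + r • dir m ∈ halfOpenSegment y (f y) →
      f ((x1, x2), m) ≤ ENNReal.ofReal (t + (7 * K + 1)) := fun hy hxy hr0 hr hmem =>
    (hf.le_of_mem_halfOpenSegment hx hy hxy hr0 hmem).trans (ENNReal.ofReal_le_ofReal hr)
  fin_cases m <;> simp [dir] at hbox
  -- The run lies ahead of the position at time `t`, within distance `7 * K + 1`. The room `14 * K +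
  -- 11 ≤ s / 4` keeps all its windows inside the square of side `3 * s`. The other marks are
  -- symmetric.
  · obtain ⟨k, hk1, hk2⟩ := (exists_run K (x1 + t)).1
    obtain ⟨l, hl1, hl2, hl3⟩ := hrow x2
    obtain ⟨⟨j, hj, hsh⟩, -⟩ := h (k, l)
      (by rw [← le_sub_iff_add_le', abs_le]; constructor <;> simp only <;> linarith)
      (by rw [← le_sub_iff_add_le', abs_le]; constructor <;> simp only <;> linarith)
    obtain ⟨y, hy, hm, hy1, hy2, hmem⟩ := hsh.vertical hgen hf
    have := hjK j hj; have := hj0 j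
    push_cast at hy1 hy2
    refine fin (r := y.1.1 - x1) hy (hne (by decide) hm) (by linarith) (by linarith) ?_
    convert hmem x2 hl1 hl2 using 1
    ext <;> simp [dir]
  · obtain ⟨k, hk1, hk2⟩ := (exists_run K (x2 + t)).1
    obtain ⟨l, hl1, hl2, hl3⟩ := hrow x1
    obtain ⟨-, ⟨j, hj, hsh⟩⟩ := h (l, k)
      (by rw [← le_sub_iff_add_le', abs_le]; constructor <;> simp only <;> linarith)
      (by rw [← le_sub_iff_add_le', abs_le]; constructor <;> simp only <;> linarith)
    obtain ⟨y, hy, hm, hy1, hy2, hmem⟩ := hsh.horizontal hgen hf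
    have := hjK j hj; have := hj0 j
    push_cast at hy1 hy2
    refine fin (r := y.1.2 - x2) hy (hne (by decide) hm) (by linarith) (by linarith) ?_
    convert hmem x1 hl1 hl2 using 1
    ext <;> simp [dir]
  · obtain ⟨k, hk1, hk2⟩ := (exists_run K (x1 - t)).2
    obtain ⟨l, hl1, hl2, hl3⟩ := hrow x2
    obtain ⟨⟨j, hj, hsh⟩, -⟩ := h (k, l)
      (by rw [← le_sub_iff_add_le', abs_le]; constructor <;> simp only <;> linarith)
      (by rw [← le_sub_iff_add_le', abs_le]; constructor <;> simp only <;> linarith)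
    obtain ⟨y, hy, hm, hy1, hy2, hmem⟩ := hsh.vertical hgen hf
    have := hjK j hj; have := hj0 j
    push_cast at hy1 hy2
    refine fin (r := x1 - y.1.1) hy (hne (by decide) hm) (by linarith) (by linarith) ?_
    convert hmem x2 hl1 hl2 using 1
    ext <;> simp [dir]
  · obtain ⟨k, hk1, hk2⟩ := (exists_run K (x2 - t)).2
    obtain ⟨l, hl1, hl2, hl3⟩ := hrow x1
    obtain ⟨-, ⟨j, hj, hsh⟩⟩ := h (l, k)
      (by rw [← le_sub_iff_add_le', abs_le]; constructor <;> simp only <;> linarith)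
      (by rw [← le_sub_iff_add_le', abs_le]; constructor <;> simp only <;> linarith)
    obtain ⟨y, hy, hm, hy1, hy2, hmem⟩ := hsh.horizontal hgen hf
    have := hjK j hj; have := hj0 j
    push_cast at hy1 hy2
    refine fin (r := x2 - y.1.2) hy (hne (by decide) hm) (by linarith) (by linarith) ?_
    convert hmem x1 hl1 hl2 using 1
    ext <;> simp [dir]

theorem norm_le_of_mem_window {s : ℝ} {z : ℤ × ℤ} (h1 : 4 + |(z.1 : ℝ)| ≤ 3 * s / 2)
    (h2 : 4 + |(z.2 : ℝ)| ≤ 3 * s / 2) {p : ℝ × ℝ} (hp : p ∈ window z) : ‖p‖ ≤ 3 * s / 2 := by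
  obtain ⟨⟨c1, c2⟩, c3, c4⟩ := hp
  simp only [Prod.norm_def, sup_le_iff, Real.norm_eq_abs, abs_le]
  have := neg_abs_le (z.1 : ℝ); have := le_abs_self (z.1 : ℝ)
  have := neg_abs_le (z.2 : ℝ); have := le_abs_self (z.2 : ℝ)
  refine ⟨⟨?_, ?_⟩, ?_, ?_⟩ <;> linarith

theorem run_abs_le {k : ℤ} {j K : ℕ} {u : ℝ} (hj : j < K) (hk : 7 * K + 8 + |(k : ℝ)| ≤ u) :
    4 + |((k + 7 * (j : ℕ) : ℤ) : ℝ)| ≤ u := by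
  have h1 : (j : ℝ) + 1 ≤ K := by exact_mod_cast hj
  have h2 := abs_add_le (k : ℝ) (7 * (j : ℝ))
  rw [abs_of_nonneg (by positivity : (0 : ℝ) ≤ 7 * j)] at h2
  push_cast
  linarith

/-- The shields only depend on the points in the square of side length `3 * s`. -/
theorem Shielded.congr {φ φ' : Set MPoint} {s : ℝ} {K : ℕ} (h : Shielded s K φ)
    (hsame : ∀ x : MPoint, ‖x.1‖ ≤ 3 * s / 2 → (x ∈ φ ↔ x ∈ φ')) : Shielded s K φ' := by
  have hsub : ∀ z, core z ⊆ window z := by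
    rintro z p ⟨⟨c1, c2⟩, c3, c4⟩
    refine ⟨⟨?_, ?_⟩, ?_, ?_⟩ <;> linarith
  have key : ∀ z : ℤ × ℤ, 4 + |(z.1 : ℝ)| ≤ 3 * s / 2 → 4 + |(z.2 : ℝ)| ≤ 3 * s / 2 →
      ∀ m, IsShield φ m z → IsShield φ' m z := by
    rintro z h1 h2 m ⟨y, hy, hm, hc, huniq⟩
    refine ⟨y, (hsame y (norm_le_of_mem_window h1 h2 (hsub z hc))).1 hy, hm, hc, fun x hx hxw => ?_⟩
    exact huniq x ((hsame x (norm_le_of_mem_window h1 h2 hxw)).2 hx) hxw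
  have hle : ∀ k : ℤ, 7 * K + 8 + |(k : ℝ)| ≤ 3 * s / 2 → 4 + |(k : ℝ)| ≤ 3 * s / 2 := by
    intro k hk
    have : (0 : ℝ) ≤ K := K.cast_nonneg
    linarith
  intro z h1 h2
  obtain ⟨⟨j, hj, hsh⟩, i, hi, hsh'⟩ := h z h1 h2
  exact ⟨⟨j, hj, key (z.1 + 7 * (j : ℕ), z.2) (run_abs_le hj h1) (hle _ h2) _ hsh⟩,
    i, hi, key (z.1, z.2 + 7 * (i : ℕ)) (hle _ h1) (run_abs_le hi h2) _ hsh'⟩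

/-! ### Chains of points with different growth -/

/-- `m + 1` distinct points in the square of side length `2 * R` such that consecutive points have
distance in `[j / D, (j + 1) / D)`. -/
def HasLevelChain (φ : Set MPoint) (R : ℝ) (D m j : ℕ) : Prop :=
  ∃ y : ℕ → MPoint, (∀ i ≤ m, y i ∈ φ ∧ ‖(y i).1‖ ≤ R) ∧
    (∀ i ≤ m, ∀ i' ≤ m, y i = y i' → i = i') ∧
    ∀ i < m, ⌊D * ‖(y i).1 - (y (i + 1)).1‖⌋₊ = j

/-- The chain moves from each point to the stopping neighbor of its shorter segment, and `ρ` is the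
smaller of the two lengths. Since `ρ ≤ b`, each step moves by at most `b`, so `N` steps stay within
`R`, and the next neighbor stays where the configurations agree. -/
theorem exists_chain {φ φ' : Set MPoint} (hgen : Generic φ) (hgen' : Generic φ')
    {f g : MPoint → ℝ≥0∞} (hf : IsGrowthFunction φ f) (hg : IsGrowthFunction φ' g)
    {R b : ℝ} (hb : 0 ≤ b)
    (hfb : ∀ x ∈ φ, ‖x.1‖ ≤ R → f x ≤ ENNReal.ofReal b)
    (hsame : ∀ x : MPoint, ‖x.1‖ ≤ R + b → (x ∈ φ ↔ x ∈ φ'))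
    {x₀ : MPoint} (hx₀ : x₀ ∈ φ) (hne : f x₀ ≠ g x₀) {N : ℕ} (hN : ‖x₀.1‖ + N * b ≤ R) :
    ∃ (ρ : MPoint → ℝ) (x : ℕ → MPoint), ∀ i ≤ N, x i ∈ φ ∧ ‖(x i).1‖ ≤ R ∧
      0 ≤ ρ (x i) ∧ ρ (x i) ≤ b ∧
      (i < N → ‖(x i).1 - (x (i + 1)).1‖ = ρ (x i) ∧ ρ (x (i + 1)) < ρ (x i)) := by
  set ρ : MPoint → ℝ := fun x => (min (f x) (g x)).toReal with hρ
  have hρb : ∀ x ∈ φ, ‖x.1‖ ≤ R → ρ x ≤ b := fun x hx hxR =>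
    ENNReal.toReal_le_of_le_ofReal hb ((min_le_left _ _).trans (hfb x hx hxR))
  have hmono : ∀ x ∈ φ, ‖x.1‖ ≤ R → ∀ y, min (f y) (g y) < min (f x) (g x) → ρ y < ρ x := by
    intro x hx hxR y hyx
    refine (ENNReal.toReal_lt_toReal hyx.ne_top ?_).2 hyx
    exact (((min_le_left _ _).trans (hfb x hx hxR)).trans_lt ENNReal.ofReal_lt_top).ne
  have step : ∀ x : MPoint, ∃ y : MPoint, x ∈ φ → f x ≠ g x → ‖x.1‖ ≤ R →
      y ∈ φ ∧ f y ≠ g y ∧ ‖x.1 - y.1‖ = ρ x ∧ ρ y < ρ x := by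
    intro x
    by_cases hx : x ∈ φ ∧ f x ≠ g x ∧ ‖x.1‖ ≤ R
    swap
    -- Default value outside the relevant points, so that the successor is a total map that can be
    -- iterated.
    · exact ⟨x, fun h1 h2 h3 => absurd ⟨h1, h2, h3⟩ hx⟩
    obtain ⟨hx, hxne, hxR⟩ := hx
    have hx' : x ∈ φ' := (hsame x (by linarith)).1 hx
    have hclose : ∀ y : MPoint, ‖x.1 - y.1‖ = ρ x → ‖y.1‖ ≤ R + b := by
      intro y hy
      have h1 := norm_sub_norm_le y.1 x.1
      rw [norm_sub_rev, hy] at h1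
      linarith [hρb x hx hxR]
    rcases lt_or_gt_of_ne hxne with h | h
    · obtain ⟨y, hy, h1, h2⟩ := exists_stopping_step_of_two hgen hf hg hx hx' h
      have h1' : ‖x.1 - y.1‖ = ρ x := by simpa [hρ, min_eq_left h.le] using h1
      obtain ⟨h3, h4⟩ := h2 ((hsame y (hclose y h1')).1 hy)
      refine ⟨y, fun _ _ _ => ⟨hy, h3.ne', h1', hmono x hx hxR y ?_⟩⟩
      simpa [min_eq_left h.le, min_eq_right h3.le] using h4
    · obtain ⟨y, hy, h1, h2⟩ := exists_stopping_step_of_two hgen' hg hf hx' hx h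
      have h1' : ‖x.1 - y.1‖ = ρ x := by simpa [hρ, min_eq_right h.le] using h1
      have hyφ := (hsame y (hclose y h1')).2 hy
      obtain ⟨h3, h4⟩ := h2 hyφ
      refine ⟨y, fun _ _ _ => ⟨hyφ, h3.ne, h1', hmono x hx hxR y ?_⟩⟩
      simpa [min_eq_right h.le, min_eq_left h3.le] using h4
  choose next hnext using step
  have hsucc : ∀ n, next^[n + 1] x₀ = next (next^[n] x₀) :=
    fun n => Function.iterate_succ_apply' _ _ _
  have hinv : ∀ i ≤ N, next^[i] x₀ ∈ φ ∧ f (next^[i] x₀) ≠ g (next^[i] x₀) ∧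
      ‖(next^[i] x₀).1‖ ≤ ‖x₀.1‖ + i * b := by
    intro i
    induction i with
    | zero => intro _; exact ⟨hx₀, hne, by simp⟩
    | succ n ih =>
      intro hn
      obtain ⟨h1, h2, h3⟩ := ih (by omega)
      have hnN : (n : ℝ) ≤ N := by exact_mod_cast (by omega : n ≤ N)
      have hR : ‖(next^[n] x₀).1‖ ≤ R := by nlinarith
      obtain ⟨k1, k2, k3, k4⟩ := hnext _ h1 h2 hR
      rw [hsucc]
      refine ⟨k1, k2, ?_⟩
      have h5 := norm_sub_norm_le (next (next^[n] x₀)).1 (next^[n] x₀).1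
      rw [norm_sub_rev, k3] at h5
      push_cast
      linarith [hρb _ h1 hR]
  refine ⟨ρ, fun i => next^[i] x₀, fun i hi => ?_⟩
  obtain ⟨h1, h2, h3⟩ := hinv i hi
  have hiN : (i : ℝ) ≤ N := by exact_mod_cast hi
  have hR : ‖(next^[i] x₀).1‖ ≤ R := by nlinarith
  refine ⟨h1, hR, ENNReal.toReal_nonneg, hρb _ h1 hR, fun _ => ?_⟩
  obtain ⟨-, -, k3, k4⟩ := hnext _ h1 h2 hR
  simp only [hsucc]
  exact ⟨k3, k4⟩

/-- An antitone sequence of naturals is constant on one of the first blocks of length `m`. -/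
theorem exists_constant_block {c : ℕ → ℕ} {J m : ℕ} (h0 : c 0 ≤ J)
    (hc : ∀ i < (J + 1) * m, c (i + 1) ≤ c i) :
    ∃ t ≤ J, ∀ i ≤ m, c (t * m + i) = c (t * m) := by
  have anti : ∀ a b, a ≤ b → b ≤ (J + 1) * m → c b ≤ c a := by
    intro a b hab
    induction b, hab using Nat.le_induction with
    | base => intro _; exact le_rfl
    | succ n hn ih => intro h; exact (hc n (by omega)).trans (ih (by omega))
  by_contra! hcon
  -- If no block were constant, each would lower the value by at least one; `J + 1` blocks are too
  -- many for a start at most `J`.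
  have key : ∀ t ≤ J + 1, c (t * m) + t ≤ J := by
    intro t
    induction t with
    | zero => intro _; simpa using h0
    | succ t ih =>
      intro ht
      obtain ⟨i, hi, hne⟩ := hcon t (by omega)
      have hle : (t + 1) * m ≤ (J + 1) * m := Nat.mul_le_mul_right m ht
      have e : (t + 1) * m = t * m + m := by ring
      have h1 := anti (t * m) (t * m + i) (by omega) (by omega)
      have h2 := anti (t * m + i) ((t + 1) * m) (by omega) hle
      have := ih (by omega)
      omega
  have := key (J + 1) le_rfl
  omega

/-- The levels `⌊D * ρ⌋₊` along the chain are antitone and take at most `b * D + 1` values, so one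
persists for `m` steps. The points are distinct because `ρ` decreases strictly. -/
theorem hasLevelChain_of_growth_ne {φ φ' : Set MPoint} (hgen : Generic φ) (hgen' : Generic φ')
    {f g : MPoint → ℝ≥0∞} (hf : IsGrowthFunction φ f) (hg : IsGrowthFunction φ' g)
    {R : ℝ} {b : ℕ}
    (hfb : ∀ x ∈ φ, ‖x.1‖ ≤ R → f x ≤ ENNReal.ofReal b)
    (hsame : ∀ x : MPoint, ‖x.1‖ ≤ R + b → (x ∈ φ ↔ x ∈ φ'))
    {x₀ : MPoint} (hx₀ : x₀ ∈ φ) (hne : f x₀ ≠ g x₀) {D m : ℕ}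
    (hN : ‖x₀.1‖ + ((b * D + 1) * m : ℕ) * b ≤ R) :
    ∃ j ≤ b * D, HasLevelChain φ R D m j := by
  obtain ⟨ρ, x, hx⟩ := exists_chain hgen hgen' hf hg (Nat.cast_nonneg b) hfb hsame hx₀ hne hN
  set N := (b * D + 1) * m with hNdef
  have hcls : ∀ i ≤ N, ⌊D * ρ (x i)⌋₊ ≤ b * D := by
    intro i hi
    refine Nat.floor_le_of_le ?_
    push_cast
    rw [mul_comm]
    exact mul_le_mul_of_nonneg_right (hx i hi).2.2.2.1 (Nat.cast_nonneg D)
  obtain ⟨t, ht, hconst⟩ := exists_constant_block (c := fun i => ⌊D * ρ (x i)⌋₊) (m := m)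
    (hcls 0 (by omega)) fun i hi => Nat.floor_le_floor
      (mul_le_mul_of_nonneg_left ((hx i hi.le).2.2.2.2 hi).2.le (Nat.cast_nonneg D))
  have htm : t * m + m ≤ N := by
    have : (t + 1) * m ≤ N := Nat.mul_le_mul_right m (by omega)
    linarith [(by ring : (t + 1) * m = t * m + m)]
  have hlt : ∀ i i', i < i' → i' ≤ N → ρ (x i') < ρ (x i) := by
    intro i i' hii
    induction i', hii using Nat.le_induction with
    | base => intro h; exact ((hx i (by omega)).2.2.2.2 (by omega)).2
    | succ n hn ih =>
      intro h
      exact ((hx n (by omega)).2.2.2.2 (by omega)).2.trans (ih (by omega))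
  refine ⟨⌊D * ρ (x (t * m))⌋₊, hcls _ (by omega), fun i => x (t * m + i), fun i hi => ?_,
    fun i hi i' hi' heq => ?_, fun i hi => ?_⟩
  · exact ⟨(hx _ (by omega)).1, (hx _ (by omega)).2.1⟩
  · by_contra hii
    have heq' := congrArg ρ heq
    rcases lt_or_gt_of_ne hii with h | h
    · exact (hlt (t * m + i) (t * m + i') (by omega) (by omega)).ne heq'.symm
    · exact (hlt (t * m + i') (t * m + i) (by omega) (by omega)).ne heq'
  · have := ((hx (t * m + i) (by omega)).2.2.2.2 (by omega)).1
    rw [← hconst i hi.le, ← this]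
    rfl

/-- If there are enough shields and no long level chains, then the segments entering the square of
side length `s` are determined by the points in the square of side length `3 * s`. -/
theorem entering_eq {φ φ' : Set MPoint} (hφ : Admissible φ) (hφ' : Admissible φ') {s : ℝ}
    {K D m : ℕ} (hs : 14 * K + 11 ≤ s / 4)
    (hN : (((7 * K + 1) * D + 1) * m * (7 * K + 1) : ℕ) ≤ s / 4)
    (hsame : ∀ x : MPoint, ‖x.1‖ ≤ 3 * s / 2 → (x ∈ φ ↔ x ∈ φ')) (hsh : Shielded s K φ)
    (hch : ∀ j ≤ (7 * K + 1) * D, ¬ HasLevelChain φ (5 * s / 4) D m j) :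
    entering s φ = entering s φ' := by
  have hK : (0 : ℝ) ≤ K := K.cast_nonneg
  have hsh' := hsh.congr hsame
  have bound : ∀ x ∈ φ, ‖x.1‖ ≤ 5 * s / 4 →
      growth φ x ≤ ENNReal.ofReal (7 * K + 1 : ℕ) := by
    intro x hx hxs
    have := hsh.growth_le hφ.generic hφ.isGrowthFunction hs hx le_rfl (by simpa using hxs)
    simpa using this
  -- A segment reaching `box s` from sup-norm above `s` has travelled at least `s / 2`. A distance
  -- `s / 4` before the meeting point it is still in the shielded region, so it would have to stop
  -- within `7 * K + 1 < s / 4`, too early.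
  have far : ∀ {θ : Set MPoint}, Admissible θ → Shielded s K θ → ∀ x ∈ entering s θ,
      ‖x.1‖ ≤ s := by
    rintro θ hθ hθs x ⟨⟨hx, -⟩, p, hp, hps⟩
    by_contra! hxs
    rw [grownSegment, segment_eq_image'] at hp
    obtain ⟨c, ⟨hc0, hc1⟩, rfl⟩ := hp
    have hfin := hθ.growth_lt_top x hx
    set a := (growth θ x).toReal with ha
    have ha0 : 0 ≤ a := ENNReal.toReal_nonneg
    have hp : x.1 + c • (geomDesc θ x - x.1) = x.1 + (c * a) • dir x.2 := by
      simp [geomDesc, endPoint, ← ha, mul_smul]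
    simp only [hp] at hps
    rw [mem_box_iff] at hps
    have hca : c * a ≤ a := by nlinarith
    have hnorm : ∀ u : ℝ, ‖u • dir x.2‖ = |u| := fun u => by
      rw [norm_smul, norm_dir, mul_one, Real.norm_eq_abs]
    have hlen : s / 2 ≤ c * a := by
      have h1 := norm_sub_norm_le x.1 (-((c * a) • dir x.2))
      rw [norm_neg, sub_neg_eq_add, hnorm, abs_of_nonneg (by positivity)] at h1
      linarith
    have hbox : ‖x.1 + (c * a - s / 4) • dir x.2‖ ≤ 5 * s / 4 := by
      have h1 := norm_sub_le (x.1 + (c * a) • dir x.2) ((s / 4) • dir x.2)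
      rw [hnorm, abs_of_nonneg (by linarith : 0 ≤ s / 4), add_sub_assoc, ← sub_smul] at h1
      linarith
    have h2 := hθs.growth_le hθ.generic hθ.isGrowthFunction hs hx (by linarith) hbox
    have h3 := ENNReal.toReal_le_of_le_ofReal (by linarith) h2
    linarith
  -- A chain starting within `s` has room `s / 4` before leaving the region of radius `5 * s / 4`;
  -- one more step still stays within `3 * s / 2`.
  have same : ∀ x ∈ φ, ‖x.1‖ ≤ s → growth φ x = growth φ' x := by
    intro x hx hxs
    by_contra hne
    obtain ⟨j, hj, hc⟩ := hasLevelChain_of_growth_ne hφ.generic hφ'.generic hφ.isGrowthFunction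
      hφ'.isGrowthFunction (R := 5 * s / 4) bound
      (fun y hy => hsame y (hy.trans (by push_cast; linarith))) hx hne (D := D) (m := m)
      (by rw [← Nat.cast_mul]; linarith)
    exact hch j hj hc
  have hseg : ∀ x ∈ φ, ‖x.1‖ ≤ s → grownSegment φ x = grownSegment φ' x := by
    intro x hx hxs
    rw [grownSegment, grownSegment, geomDesc, geomDesc, same x hx hxs]
  ext x
  constructor
  · intro hx
    have hxs := far hφ hsh x hx
    obtain ⟨⟨hxφ, hxo⟩, hxe⟩ := hx
    rw [hseg x hxφ hxs] at hxe
    exact ⟨⟨(hsame x (by linarith)).1 hxφ, hxo⟩, hxe⟩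
  · intro hx
    have hxs := far hφ' hsh' x hx
    obtain ⟨⟨hxφ', hxo⟩, hxe⟩ := hx
    have hxφ := (hsame x (by linarith)).2 hxφ'
    rw [← hseg x hxφ hxs] at hxe
    exact ⟨⟨hxφ, hxo⟩, hxe⟩

/-! ### Counts of Poisson processes -/

theorem Config.measurable_count {B : Set MPoint} (hB : MeasurableSet B) :
    Measurable (Config.count B) :=
  measurable_iff_comap_le.2 ((MeasurableSpace.comap_mono le_top).trans
    (le_iSup (fun B : {B : Set MPoint // MeasurableSet B} =>
      MeasurableSpace.comap (Config.count B.1) ⊤) ⟨B, hB⟩))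

theorem Config.count_restrict_le (φ : Config) (B C : Set MPoint) :
    Config.count B (φ.restrict C) ≤ Config.count B φ :=
  encard_le_encard fun _ hx => ⟨hx.1.1, hx.2⟩

theorem Config.count_restrict_of_subset (φ : Config) {B C : Set MPoint} (h : B ⊆ C) :
    Config.count B (φ.restrict C) = Config.count B φ := by
  unfold Config.count Config.restrict
  congr 1
  ext x
  exact ⟨fun hx => ⟨hx.1.1, hx.2⟩, fun hx => ⟨⟨hx.1, h hx.2⟩, hx.2⟩⟩

theorem markedIntensity_prod (γ : ℝ) (S : Set (ℝ × ℝ)) (T : Set Mark) :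
    markedIntensity γ (S ×ˢ T) = ENNReal.ofReal γ * (volume S * uniformOn (univ : Set Mark) T) := by
  rw [markedIntensity, Measure.smul_apply, smul_eq_mul, Measure.prod_prod]

theorem uniformOn_mark_singleton (m : Mark) :
    uniformOn (univ : Set Mark) {m} = ENNReal.ofReal (1 / 4) := by
  rw [uniformOn_univ]
  simp

theorem uniformOn_mark_univ : uniformOn (univ : Set Mark) univ = 1 :=
  uniformOn_of_univ finite_univ univ_nonempty

section

variable {Ω : Type*} [MeasurableSpace Ω] {P : Measure Ω} {Λ : Measure MPoint} {X : Ω → Config}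

theorem IsPoissonProcess.measurableSet_count (hX : IsPoissonProcess P Λ X) {B : Set MPoint}
    (hB : MeasurableSet B) (S : Set ℕ∞) : MeasurableSet {ω | Config.count B (X ω) ∈ S} :=
  ((Config.measurable_count hB).comp hX.measurable) S.to_countable.measurableSet

theorem IsPoissonProcess.measure_count_eq (hX : IsPoissonProcess P Λ X) {B : Set MPoint}
    (hB : MeasurableSet B) {r : ℝ} (hr : 0 ≤ r) (hΛ : Λ B = ENNReal.ofReal r) (k : ℕ) :
    P {ω | Config.count B (X ω) = k} =
      ENNReal.ofReal (Real.exp (-r) * r ^ k / (k.factorial : ℝ)) := by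
  have h := hX.count_law B hB (by rw [hΛ]; exact ENNReal.ofReal_lt_top)
  rw [h.measure_eq (p := fun n => n = (k : ℕ∞)) (to_countable _).measurableSet,
    Measure.map_apply (by fun_prop) (to_countable _).measurableSet]
  have : (fun n : ℕ => (n : ℕ∞)) ⁻¹' {n | n = (k : ℕ∞)} = {k} := by
    ext n; simp
  have hr' : ((ENNReal.ofReal r).toNNReal : ℝ) = r := ENNReal.toReal_ofReal hr
  rw [this, poissonMeasure_singleton, hΛ, hr']

theorem IsPoissonProcess.measure_count_ne_zero_le [IsProbabilityMeasure P]
    (hX : IsPoissonProcess P Λ X) {B : Set MPoint}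
    (hB : MeasurableSet B) {r : ℝ} (hr : 0 ≤ r) (hΛ : Λ B = ENNReal.ofReal r) :
    P {ω | Config.count B (X ω) ≠ 0} ≤ ENNReal.ofReal r := by
  have h0 := hX.measure_count_eq hB hr hΛ 0
  have hm := hX.measurableSet_count hB {0}
  have hc : {ω | Config.count B (X ω) ≠ 0} = {ω | Config.count B (X ω) ∈ ({0} : Set ℕ∞)}ᶜ := by
    ext; simp
  rw [hc, prob_compl_eq_one_sub hm]
  simp only [mem_singleton_iff]
  simp only [Nat.cast_zero, pow_zero, mul_one, Nat.factorial_zero, Nat.cast_one, div_one] at h0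
  rw [h0, ← ENNReal.ofReal_one, ← ENNReal.ofReal_sub _ (Real.exp_nonneg _)]
  exact ENNReal.ofReal_le_ofReal (by linarith [Real.add_one_le_exp (-r)])

theorem IsPoissonProcess.measure_one_lt_count_le [IsProbabilityMeasure P]
    (hX : IsPoissonProcess P Λ X) {B : Set MPoint}
    (hB : MeasurableSet B) {r : ℝ} (hr : 0 ≤ r) (hΛ : Λ B = ENNReal.ofReal r) :
    P {ω | 1 < Config.count B (X ω)} ≤ ENNReal.ofReal (r ^ 2) := by
  have h0 := hX.measure_count_eq hB hr hΛ 0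
  have h1 := hX.measure_count_eq hB hr hΛ 1
  have hm := hX.measurableSet_count hB {0, 1}
  have hc : {ω | 1 < Config.count B (X ω)} =
      {ω | Config.count B (X ω) ∈ ({0, 1} : Set ℕ∞)}ᶜ := by
    ext ω
    simp only [mem_ofPred_eq, mem_compl_iff, mem_insert_iff, mem_singleton_iff]
    rw [← Order.le_one_iff, not_le]
  have hu : {ω | Config.count B (X ω) ∈ ({0, 1} : Set ℕ∞)} =
      {ω | Config.count B (X ω) = (0 : ℕ)} ∪ {ω | Config.count B (X ω) = (1 : ℕ)} := by
    ext ω; simp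
  have hd : Disjoint {ω | Config.count B (X ω) = (0 : ℕ)}
      {ω | Config.count B (X ω) = (1 : ℕ)} := by
    rw [Set.disjoint_left]
    intro ω h h'
    simp only [mem_ofPred_eq] at h h'
    rw [h] at h'
    simp at h'
  rw [hc, prob_compl_eq_one_sub hm, hu,
    measure_union hd (hX.measurableSet_count hB {((1 : ℕ) : ℕ∞)}), h0, h1,
    ← ENNReal.ofReal_add (by positivity) (by positivity), ← ENNReal.ofReal_one,
    ← ENNReal.ofReal_sub _ (by positivity)]
  refine ENNReal.ofReal_le_ofReal ?_
  -- From `exp (-r) ≥ 1 - r` follows `1 - exp (-r) * (1 + r) ≤ 1 - (1 - r) * (1 + r) = r ^ 2`.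
  have := Real.add_one_le_exp (-r)
  simp
  nlinarith

theorem IsPoissonProcess.iIndepFun_count (hX : IsPoissonProcess P Λ X) {ι : Type*} [Fintype ι]
    {B : ι → Set MPoint} (hB : ∀ i, MeasurableSet (B i))
    (hd : Pairwise fun i j => Disjoint (B i) (B j)) :
    iIndepFun (fun i ω => Config.count (B i) (X ω)) P := by
  have e := Fintype.equivFin ι
  have h := hX.indep _ (fun i => B (e.symm i)) (fun i => hB _)
    fun i j hij => hd (e.symm.injective.ne hij)
  simpa using h.precomp e.injective

theorem IsPoissonProcess.measure_forall_count_ne_zero_le [IsProbabilityMeasure P]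
    (hX : IsPoissonProcess P Λ X)
    {ι : Type*} [Fintype ι] {B : ι → Set MPoint} (hB : ∀ i, MeasurableSet (B i))
    (hd : Pairwise fun i j => Disjoint (B i) (B j)) {r : ℝ} (hr : 0 ≤ r)
    (hΛ : ∀ i, Λ (B i) = ENNReal.ofReal r) :
    P {ω | ∀ i, Config.count (B i) (X ω) ≠ 0} ≤ ENNReal.ofReal (r ^ Fintype.card ι) := by
  have h := (hX.iIndepFun_count hB hd).measure_inter_preimage_eq_mul (S := Finset.univ)
    (sets := fun _ => {n : ℕ∞ | n ≠ 0}) fun _ _ => (to_countable _).measurableSet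
  have hset : {ω | ∀ i, Config.count (B i) (X ω) ≠ 0} =
      ⋂ i ∈ Finset.univ, (fun ω => Config.count (B i) (X ω)) ⁻¹' {n : ℕ∞ | n ≠ 0} := by
    ext; simp
  rw [hset, h, ENNReal.ofReal_pow hr]
  refine (Finset.prod_le_pow_card _ _ (ENNReal.ofReal r) fun i _ => ?_).trans_eq (by simp)
  exact hX.measure_count_ne_zero_le (hB i) hr (hΛ i)

end

/-! ### The probability of shields -/

theorem measurableSet_core (z : ℤ × ℤ) : MeasurableSet (core z) :=
  measurableSet_Ico.prod measurableSet_Ico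

theorem measurableSet_window (z : ℤ × ℤ) : MeasurableSet (window z) :=
  measurableSet_Ico.prod measurableSet_Ico

theorem core_subset_window (z : ℤ × ℤ) : core z ⊆ window z :=
  prod_mono (Ico_subset_Ico (by linarith) (by linarith))
    (Ico_subset_Ico (by linarith) (by linarith))

/-- The marked core at `z` that contains the point of a shield. -/
def shieldCore (m : Mark) (z : ℤ × ℤ) : Set MPoint := core z ×ˢ {m}

/-- The part of the marked window at `z` that contains no points if there is a shield. -/
def shieldGap (m : Mark) (z : ℤ × ℤ) : Set MPoint := window z ×ˢ univ \ shieldCore m z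

/-- The configurations with a shield in the window at `z`. -/
def shieldEvent (m : Mark) (z : ℤ × ℤ) : Set Config :=
  {η | Config.count (shieldCore m z) η = 1 ∧ Config.count (shieldGap m z) η = 0}

theorem measurableSet_shieldCore (m : Mark) (z : ℤ × ℤ) : MeasurableSet (shieldCore m z) :=
  (measurableSet_core z).prod (measurableSet_singleton m)

theorem measurableSet_shieldGap (m : Mark) (z : ℤ × ℤ) : MeasurableSet (shieldGap m z) :=
  ((measurableSet_window z).prod MeasurableSet.univ).diff (measurableSet_shieldCore m z)

theorem shieldCore_subset (m : Mark) (z : ℤ × ℤ) : shieldCore m z ⊆ window z ×ˢ univ :=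
  prod_mono (core_subset_window z) (subset_univ _)

theorem shieldGap_subset (m : Mark) (z : ℤ × ℤ) : shieldGap m z ⊆ window z ×ˢ univ :=
  sdiff_subset

theorem measurableSet_shieldEvent (m : Mark) (z : ℤ × ℤ) : MeasurableSet (shieldEvent m z) :=
  (Config.measurable_count (measurableSet_shieldCore m z)
    (to_countable {(1 : ℕ∞)}).measurableSet).inter
  (Config.measurable_count (measurableSet_shieldGap m z) (to_countable {(0 : ℕ∞)}).measurableSet)

/-- Phrasing shields through counts on two disjoint sets gives measurability and independence; only
this implication is needed. -/
theorem isShield_of_mem_shieldEvent {m : Mark} {z : ℤ × ℤ} {η : Config}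
    (h : η ∈ shieldEvent m z) : IsShield η.1 m z := by
  obtain ⟨h1, h0⟩ := h
  obtain ⟨y, hy⟩ := encard_eq_one.1 h1
  have hy' : y ∈ η.1 ∩ shieldCore m z := by rw [hy]; rfl
  refine ⟨y, hy'.1, hy'.2.2, hy'.2.1, fun x hx hxw => ?_⟩
  by_cases hxc : x ∈ shieldCore m z
  · have : x ∈ η.1 ∩ shieldCore m z := ⟨hx, hxc⟩
    rwa [hy] at this
  · have : x ∈ η.1 ∩ shieldGap m z := ⟨hx, ⟨hxw, trivial⟩, hxc⟩
    rw [encard_eq_zero.1 h0] at this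
    exact absurd this (notMem_empty x)

/-- A lower bound for the probability that there is a shield in a given window. -/
noncomputable def shieldProb (lam : ℝ) : ℝ := lam / 8 * Real.exp (-(50 * lam))

theorem shieldProb_pos {lam : ℝ} (hlam : 0 < lam) : 0 < shieldProb lam := by
  unfold shieldProb; positivity

theorem shieldProb_le_one (lam : ℝ) : shieldProb lam ≤ 1 := by
  have hexp : Real.exp (-(50 * lam)) * (50 * lam + 1) ≤ 1 := by
    rw [Real.exp_neg, inv_mul_le_iff₀ (Real.exp_pos _), mul_one]
    exact Real.add_one_le_exp _
  unfold shieldProb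
  nlinarith [Real.exp_nonneg (-(50 * lam))]

theorem volume_core (z : ℤ × ℤ) : volume (core z) = 1 := by
  rw [core, Measure.volume_eq_prod, Measure.prod_prod, Real.volume_Ico, Real.volume_Ico]
  simp

theorem volume_window (z : ℤ × ℤ) : volume (window z) = ENNReal.ofReal 49 := by
  rw [window, Measure.volume_eq_prod, Measure.prod_prod, Real.volume_Ico, Real.volume_Ico,
    ← ENNReal.ofReal_mul (by linarith)]
  congr 1
  ring

section

variable {Ω : Type*} [MeasurableSpace Ω] {P : Measure Ω} [IsProbabilityMeasure P]
  {γ lam : ℝ} {X : Ω → Config}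

theorem markedIntensity_shieldCore (hγ : 0 ≤ γ) (m : Mark) (z : ℤ × ℤ) :
    markedIntensity γ (shieldCore m z) = ENNReal.ofReal (γ / 4) := by
  rw [shieldCore, markedIntensity_prod, volume_core, uniformOn_mark_singleton, one_mul,
    ← ENNReal.ofReal_mul hγ]
  congr 1
  ring

theorem markedIntensity_shieldGap (hγ : 0 ≤ γ) (m : Mark) (z : ℤ × ℤ) :
    ∃ r : ℝ, 0 ≤ r ∧ r ≤ 49 * γ ∧ markedIntensity γ (shieldGap m z) = ENNReal.ofReal r := by
  have hle : markedIntensity γ (shieldGap m z) ≤ ENNReal.ofReal (49 * γ) := by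
    refine (measure_mono (shieldGap_subset m z)).trans_eq ?_
    rw [markedIntensity_prod, volume_window, uniformOn_mark_univ, mul_one,
      ← ENNReal.ofReal_mul hγ, mul_comm]
  exact ⟨_, ENNReal.toReal_nonneg, ENNReal.toReal_le_of_le_ofReal (by positivity) hle,
    (ENNReal.ofReal_toReal (hle.trans_lt ENNReal.ofReal_lt_top).ne).symm⟩

/-- The right side is the probability of one point in the marked core times that of an empty gap.
The bounds on `γ` give `lam / 8 ≤ γ / 4` and `γ / 4 + r ≤ 50 * lam`, hence a bound uniform in `s`.
-/
theorem shieldProb_le (hlam : 0 < lam) (h1 : lam / 2 ≤ γ) (h2 : γ ≤ lam) {r : ℝ}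
    (hr : r ≤ 49 * γ) :
    shieldProb lam ≤ (Real.exp (-(γ / 4)) * (γ / 4)) * Real.exp (-r) := by
  have h3 : Real.exp (-(50 * lam)) ≤ Real.exp (-(γ / 4)) * Real.exp (-r) := by
    rw [← Real.exp_add]
    exact Real.exp_le_exp.2 (by linarith)
  calc shieldProb lam ≤ γ / 4 * (Real.exp (-(γ / 4)) * Real.exp (-r)) :=
        mul_le_mul (by linarith) h3 (Real.exp_nonneg _) (by linarith)
    _ = _ := by ring

/-- In disjoint windows the shields are independent. -/
theorem IsPoissonProcess.measure_forall_notMem_shieldEvent_le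
    (hX : IsPoissonProcess P (markedIntensity γ) X) (hlam : 0 < lam) (h1 : lam / 2 ≤ γ)
    (h2 : γ ≤ lam) (m : Mark) {K : ℕ} {z : Fin K → ℤ × ℤ}
    (hz : Pairwise fun i j => Disjoint (window (z i)) (window (z j))) :
    P {ω | ∀ i, X ω ∉ shieldEvent m (z i)} ≤ ENNReal.ofReal ((1 - shieldProb lam) ^ K) := by
  have hγ : 0 ≤ γ := by linarith
  -- All cores and gaps form one disjoint family. Grouping its independent counts in pairs yields
  -- independence of the shield events, and then of their complements.
  set B : Fin K × Bool → Set MPoint := fun q =>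
    if q.2 then shieldCore m (z q.1) else shieldGap m (z q.1) with hB
  have hBm : ∀ q, MeasurableSet (B q) := by
    rintro ⟨i, c⟩
    cases c
    · exact measurableSet_shieldGap m (z i)
    · exact measurableSet_shieldCore m (z i)
  have hBw : ∀ i c, B (i, c) ⊆ window (z i) ×ˢ univ := by
    rintro i c
    cases c
    · exact shieldGap_subset m (z i)
    · exact shieldCore_subset m (z i)
  have hBd : Pairwise fun p q => Disjoint (B p) (B q) := by
    rintro ⟨i, c⟩ ⟨j, d⟩ hne
    by_cases hij : i = j
    · subst hij
      cases c <;> cases d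
      · exact absurd rfl hne
      · exact disjoint_sdiff_left
      · exact disjoint_sdiff_right
      · exact absurd rfl hne
    · exact (Disjoint.set_prod_left (hz hij) _ _).mono (hBw i c) (hBw j d)
  have hind := hX.iIndepFun_count hBm hBd
  set S : Bool → Set ℕ∞ := fun c => if c then {1} else {0} with hS
  set G : Fin K → Set Ω := fun i => X ⁻¹' shieldEvent m (z i) with hG
  have hGm : ∀ i, MeasurableSet (G i) := fun i => hX.measurable (measurableSet_shieldEvent m (z i))
  have hGeq : ∀ i, G i = ⋂ c : Bool, (fun ω => Config.count (B (i, c)) (X ω)) ⁻¹' S c := by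
    intro i
    ext ω
    simp [hG, hB, hS, shieldEvent, and_comm]
  have hprod : ∀ s : Finset (Fin K), P (⋂ i ∈ s, G i) =
      ∏ i ∈ s, ∏ c : Bool, P ((fun ω => Config.count (B (i, c)) (X ω)) ⁻¹' S c) := by
    intro s
    have h := hind.measure_inter_preimage_eq_mul (S := s ×ˢ Finset.univ)
      (sets := fun q => S q.2) fun _ _ => (to_countable _).measurableSet
    rw [Finset.prod_product] at h
    rw [← h]
    congr 1
    ext ω
    simp only [mem_iInter, hGeq, Finset.mem_product, Finset.mem_univ, and_true, Prod.forall]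
    tauto
  have hGi : ∀ i, P (G i) =
      ∏ c : Bool, P ((fun ω => Config.count (B (i, c)) (X ω)) ⁻¹' S c) := by
    intro i
    simpa using hprod {i}
  have hset : iIndepSet G P := by
    rw [iIndepSet_iff_meas_biInter hGm]
    intro s
    rw [hprod]
    exact Finset.prod_congr rfl fun i _ => (hGi i).symm
  have hcompl : P (⋂ i ∈ (Finset.univ : Finset (Fin K)), (G i)ᶜ) = ∏ i, P (G i)ᶜ :=
    iIndep.meas_biInter hset fun i _ =>
      (MeasurableSpace.measurableSet_generateFrom (mem_singleton (G i))).compl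
  have hev : {ω | ∀ i, X ω ∉ shieldEvent m (z i)} =
      ⋂ i ∈ (Finset.univ : Finset (Fin K)), (G i)ᶜ := by
    ext; simp [hG]
  have hbound : ∀ i, P (G i)ᶜ ≤ ENNReal.ofReal (1 - shieldProb lam) := by
    intro i
    obtain ⟨r, hr0, hr, hΛ⟩ := markedIntensity_shieldGap hγ m (z i)
    have e1 := hX.measure_count_eq (measurableSet_shieldCore m (z i)) (by positivity)
      (markedIntensity_shieldCore hγ m (z i)) 1
    have e0 := hX.measure_count_eq (measurableSet_shieldGap m (z i)) hr0 hΛ 0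
    have hPG : P (G i) =
        ENNReal.ofReal (Real.exp (-(γ / 4)) * (γ / 4) * Real.exp (-r)) := by
      rw [hGi i, Fintype.prod_bool, ENNReal.ofReal_mul (by positivity)]
      congr 1
      · refine Eq.trans ?_ (e1.trans (by simp))
        congr 1
      · refine Eq.trans ?_ (e0.trans (by simp))
        congr 1
    rw [prob_compl_eq_one_sub (hGm i), hPG, ← ENNReal.ofReal_one,
      ← ENNReal.ofReal_sub _ (by positivity)]
    exact ENNReal.ofReal_le_ofReal (by linarith [shieldProb_le hlam h1 h2 hr])
  have hp : 0 ≤ 1 - shieldProb lam := sub_nonneg.2 (shieldProb_le_one lam)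
  rw [hev, hcompl, ENNReal.ofReal_pow hp]
  exact (Finset.prod_le_pow_card _ _ _ fun i _ => hbound i).trans_eq (by simp)

end

/-! ### Cells and occupied paths of cells -/

/-- The cell with index `z` in the grid of mesh `1 / M`. -/
def cell (M : ℕ) (z : ℤ × ℤ) : Set MPoint :=
  (Ico ((z.1 : ℝ) / M) ((z.1 + 1) / M) ×ˢ Ico ((z.2 : ℝ) / M) ((z.2 + 1) / M)) ×ˢ univ

/-- The index of the cell that contains `p`. -/
noncomputable def cellIndex (M : ℕ) (p : ℝ × ℝ) : ℤ × ℤ := (⌊p.1 * M⌋, ⌊p.2 * M⌋)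

theorem mem_cell_iff {M : ℕ} (hM : 0 < M) {z : ℤ × ℤ} {x : MPoint} :
    x ∈ cell M z ↔ cellIndex M x.1 = z := by
  have hM' : (0 : ℝ) < M := by exact_mod_cast hM
  simp only [cell, cellIndex, mem_prod, mem_Ico, mem_univ, and_true, Prod.ext_iff,
    Int.floor_eq_iff, div_le_iff₀ hM', lt_div_iff₀ hM']

theorem measurableSet_cell (M : ℕ) (z : ℤ × ℤ) : MeasurableSet (cell M z) :=
  (measurableSet_Ico.prod measurableSet_Ico).prod MeasurableSet.univ

theorem disjoint_cell {M : ℕ} (hM : 0 < M) {z z' : ℤ × ℤ} (h : z ≠ z') :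
    Disjoint (cell M z) (cell M z') := by
  rw [Set.disjoint_left]
  intro x hx hx'
  rw [mem_cell_iff hM] at hx hx'
  exact h (hx.symm.trans hx')

theorem markedIntensity_cell {γ : ℝ} (hγ : 0 ≤ γ) (M : ℕ) (z : ℤ × ℤ) :
    markedIntensity γ (cell M z) = ENNReal.ofReal (γ / M ^ 2) := by
  rw [cell, markedIntensity_prod, uniformOn_mark_univ, mul_one, Measure.volume_eq_prod,
    Measure.prod_prod, Real.volume_Ico, Real.volume_Ico,
    ← ENNReal.ofReal_mul (by rw [← sub_div]; simp), ← ENNReal.ofReal_mul hγ]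
  congr 1
  ring

/-- The indices of sup-norm at most `L`. -/
noncomputable def grid (L : ℕ) : Finset (ℤ × ℤ) := Finset.Icc (-L : ℤ) L ×ˢ Finset.Icc (-L : ℤ) L

theorem card_grid (L : ℕ) : (grid L).card = (2 * L + 1) ^ 2 := by
  rw [grid, Finset.card_product, Int.card_Icc, sq]
  congr 1 <;> omega

theorem mem_grid {L : ℕ} {z : ℤ × ℤ} : z ∈ grid L ↔ |z.1| ≤ L ∧ |z.2| ≤ L := by
  simp [grid, abs_le]

/-- The differences of indices of cells which contain points at distance in
`[j / D, (j + 1) / D)`, if the mesh is `1 / (w * D)`. -/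
noncomputable def annulus (w j : ℕ) : Finset (ℤ × ℤ) :=
  (Finset.Icc (j * w - 1) ((j + 1) * w + 1)).biUnion fun n => Finset.box n

theorem mem_annulus {w j : ℕ} {d : ℤ × ℤ} :
    d ∈ annulus w j ↔ j * w ≤ max |d.1| |d.2| + 1 ∧ max |d.1| |d.2| ≤ (j + 1) * w + 1 := by
  simp only [annulus, Finset.mem_biUnion, Finset.mem_Icc, Int.mem_box]
  have hmax : ((max d.1.natAbs d.2.natAbs : ℕ) : ℤ) = max |d.1| |d.2| := by
    push_cast [Int.natCast_natAbs]; rfl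
  constructor
  · rintro ⟨n, ⟨h1, h2⟩, h3⟩
    rw [← hmax, h3]
    have h1' : j * w ≤ n + 1 := by omega
    exact ⟨by exact_mod_cast h1', by exact_mod_cast h2⟩
  · rintro ⟨h1, h2⟩
    rw [← hmax] at h1 h2
    have h1' : j * w ≤ max d.1.natAbs d.2.natAbs + 1 := by exact_mod_cast h1
    exact ⟨_, ⟨by omega, by exact_mod_cast h2⟩, rfl⟩

theorem card_annulus_le (w j : ℕ) :
    (annulus w j).card ≤ (w + 3) * (8 * ((j + 1) * w + 1) + 1) := by
  refine (Finset.card_biUnion_le_card_mul _ _ (8 * ((j + 1) * w + 1) + 1) fun n hn => ?_).trans ?_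
  -- The sup-norm sphere of radius `n` in `ℤ × ℤ` has `8 * n` points, except for a single point at
  -- radius `0`; hence the extra one.
  · rcases eq_or_ne n 0 with rfl | h
    · simp
    · rw [Int.card_box h]
      have := (Finset.mem_Icc.1 hn).2
      omega
  · refine Nat.mul_le_mul_right _ ?_
    rw [Nat.card_Icc]
    have : (j + 1) * w = j * w + w := by ring
    omega

theorem cellIndex_sub_mem_annulus {w D j : ℕ} (hw : 0 < w) (hD : 0 < D) {p q : ℝ × ℝ}
    (h : ⌊D * ‖p - q‖⌋₊ = j) : cellIndex (w * D) q - cellIndex (w * D) p ∈ annulus w j := by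
  have hw' : (0 : ℝ) < w := by exact_mod_cast hw
  have hD' : (0 : ℝ) < D := by exact_mod_cast hD
  rw [Nat.floor_eq_iff (by positivity)] at h
  -- Rounding changes a coordinate difference by less than one, which accounts for the extra unit at
  -- both radii of `annulus`.
  have key : ∀ u v : ℝ, |(((⌊v * (w * D : ℕ)⌋ - ⌊u * (w * D : ℕ)⌋ : ℤ) : ℝ))|
      < w * (D * |u - v|) + 1 ∧
      w * (D * |u - v|) - 1 < |(((⌊v * (w * D : ℕ)⌋ - ⌊u * (w * D : ℕ)⌋ : ℤ) : ℝ))| := by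
    intro u v
    have e : (w : ℝ) * (D * |u - v|) = |v * (w * D : ℕ) - u * (w * D : ℕ)| := by
      rw [← sub_mul, abs_mul, abs_of_nonneg (Nat.cast_nonneg (α := ℝ) (w * D)), abs_sub_comm]
      push_cast
      ring
    rw [e]
    have h1 := Int.floor_le (v * (w * D : ℕ)); have h2 := Int.lt_floor_add_one (v * (w * D : ℕ))
    have h3 := Int.floor_le (u * (w * D : ℕ)); have h4 := Int.lt_floor_add_one (u * (w * D : ℕ))
    set a := v * (w * D : ℕ)
    set b := u * (w * D : ℕ)
    have h5 : |((⌊a⌋ - ⌊b⌋ : ℤ) : ℝ) - (a - b)| < 1 := by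
      push_cast
      rw [abs_lt]
      constructor <;> linarith
    have h6 := abs_sub_abs_le_abs_sub ((⌊a⌋ - ⌊b⌋ : ℤ) : ℝ) (a - b)
    have h7 := abs_sub_abs_le_abs_sub (a - b) ((⌊a⌋ - ⌊b⌋ : ℤ) : ℝ)
    rw [abs_sub_comm (a - b)] at h7
    constructor <;> linarith
  obtain ⟨k1, k2⟩ := key p.1 q.1
  obtain ⟨k3, k4⟩ := key p.2 q.2
  rw [mem_annulus]
  simp only [cellIndex, Prod.fst_sub, Prod.snd_sub]
  set d1 := ⌊q.1 * (w * D : ℕ)⌋ - ⌊p.1 * (w * D : ℕ)⌋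
  set d2 := ⌊q.2 * (w * D : ℕ)⌋ - ⌊p.2 * (w * D : ℕ)⌋
  simp only [Prod.norm_def, Prod.fst_sub, Prod.snd_sub, Real.norm_eq_abs] at h
  set a1 := |p.1 - q.1|
  set a2 := |p.2 - q.2|
  have up : ∀ a, a ≤ max a1 a2 → w * (D * a) ≤ (j + 1) * (w : ℝ) := by
    intro a ha
    have : D * a ≤ D * max a1 a2 := mul_le_mul_of_nonneg_left ha hD'.le
    rw [mul_comm]
    exact mul_le_mul_of_nonneg_right (this.trans h.2.le) hw'.le
  have low : j * (w : ℝ) ≤ w * (D * max a1 a2) := by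
    rw [mul_comm]
    exact mul_le_mul_of_nonneg_left h.1 hw'.le
  constructor
  · rcases max_cases a1 a2 with ⟨e, -⟩ | ⟨e, -⟩
    · rw [e] at low
      have h1 : (j * w : ℝ) ≤ |(d1 : ℝ)| + 1 := by linarith
      have h2 : (j * w : ℤ) ≤ |d1| + 1 := by exact_mod_cast h1
      exact h2.trans (by gcongr; exact le_max_left _ _)
    · rw [e] at low
      have h1 : (j * w : ℝ) ≤ |(d2 : ℝ)| + 1 := by linarith
      have h2 : (j * w : ℤ) ≤ |d2| + 1 := by exact_mod_cast h1
      exact h2.trans (by gcongr; exact le_max_right _ _)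
  · refine max_le ?_ ?_
    · have h1 : |(d1 : ℝ)| ≤ (j + 1) * w + 1 := by linarith [up a1 (le_max_left _ _)]
      exact_mod_cast h1
    · have h1 : |(d2 : ℝ)| ≤ (j + 1) * w + 1 := by linarith [up a2 (le_max_right _ _)]
      exact_mod_cast h1

/-! ### Grid events that exclude level chains -/

/-- The configurations with at most one point in every cell of the grid. -/
def sparseEvent (M L : ℕ) : Set Config :=
  {η | ∀ z ∈ grid L, Config.count (cell M z) η ≤ 1}

/-- The configurations with an empty cell on every self-avoiding path of `m` steps in
`annulus w j` that starts in the grid. -/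
def noPathEvent (M L m w j : ℕ) : Set Config :=
  {η | ∀ q ∈ grid L ×ˢ Fintype.piFinset fun _ : Fin m => annulus w j,
    Function.Injective (fun i => q.1 + Fin.partialSum q.2 i) →
      ∃ i, Config.count (cell M (q.1 + Fin.partialSum q.2 i)) η = 0}

theorem measurableSet_sparseEvent (M L : ℕ) : MeasurableSet (sparseEvent M L) := by
  have : sparseEvent M L = ⋂ z ∈ grid L, Config.count (cell M z) ⁻¹' Iic 1 := by
    ext; simp [sparseEvent]
  rw [this]
  exact Finset.measurableSet_biInter _ fun z _ =>
    Config.measurable_count (measurableSet_cell M z) (to_countable _).measurableSet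

theorem measurableSet_noPathEvent (M L m w j : ℕ) : MeasurableSet (noPathEvent M L m w j) := by
  have : noPathEvent M L m w j =
      ⋂ q ∈ grid L ×ˢ Fintype.piFinset fun _ : Fin m => annulus w j,
        ⋂ _ : Function.Injective (fun i => q.1 + Fin.partialSum q.2 i),
          ⋃ i, Config.count (cell M (q.1 + Fin.partialSum q.2 i)) ⁻¹' {0} := by
    ext; simp only [noPathEvent, mem_ofPred_eq, mem_iInter, mem_iUnion, mem_preimage,
      mem_singleton_iff]
  rw [this]
  exact Finset.measurableSet_biInter _ fun q _ => MeasurableSet.iInter fun _ =>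
    MeasurableSet.iUnion fun i =>
      Config.measurable_count (measurableSet_cell M _) (to_countable _).measurableSet

/-- Sparsity puts the distinct points of a level chain into distinct cells. Their indices then trace
a self-avoiding occupied path with increments in the annulus. -/
theorem not_hasLevelChain {η : Config} {R : ℝ} {w D m j L : ℕ} (hw : 0 < w) (hD : 0 < D)
    (hL : R * (w * D : ℕ) + 1 ≤ L) (hs : η ∈ sparseEvent (w * D) L)
    (hp : η ∈ noPathEvent (w * D) L m w j) : ¬ HasLevelChain η.1 R D m j := by
  rintro ⟨y, hy, hinj, hlev⟩
  have hM : 0 < w * D := Nat.mul_pos hw hD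
  set c : ℕ → ℤ × ℤ := fun i => cellIndex (w * D) (y i).1 with hc
  have habs : ∀ u : ℝ, |u| ≤ R → |⌊u * (w * D : ℕ)⌋| ≤ (L : ℤ) := by
    intro u hu
    have hM' : (0 : ℝ) ≤ (w * D : ℕ) := Nat.cast_nonneg _
    have h1 : |u * (w * D : ℕ)| ≤ R * (w * D : ℕ) := by
      rw [abs_mul, abs_of_nonneg hM']
      exact mul_le_mul_of_nonneg_right hu hM'
    rw [abs_le] at h1
    have h2 := Int.floor_le (u * (w * D : ℕ)); have h3 := Int.lt_floor_add_one (u * (w * D : ℕ))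
    have h4 : |(⌊u * (w * D : ℕ)⌋ : ℝ)| ≤ L := by
      rw [abs_le]
      constructor <;> linarith [h1.1, h1.2]
    exact_mod_cast h4
  have hgrid : ∀ i ≤ m, c i ∈ grid L := by
    intro i hi
    have h := (hy i hi).2
    simp only [Prod.norm_def, sup_le_iff, Real.norm_eq_abs] at h
    exact mem_grid.2 ⟨habs _ h.1, habs _ h.2⟩
  have hmem : ∀ i, y i ∈ cell (w * D) (c i) := fun i => (mem_cell_iff hM).2 rfl
  have hcinj : ∀ i ≤ m, ∀ i' ≤ m, c i = c i' → i = i' := by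
    intro i hi i' hi' h
    have h1 := encard_le_one_iff.1 (hs _ (hgrid i hi))
    exact hinj i hi i' hi' (h1 _ _ ⟨(hy i hi).1, hmem i⟩ ⟨(hy i' hi').1, h ▸ hmem i'⟩)
  set d : Fin m → ℤ × ℤ := fun k => c (k + 1) - c k with hd
  have hsum : ∀ i : Fin (m + 1), c 0 + Fin.partialSum d i = c i := by
    intro i
    induction i using Fin.induction with
    | zero => simp
    | succ k ih => rw [Fin.partialSum_succ, ← add_assoc, ih]; simp [hd]
  obtain ⟨i, hi⟩ := hp (c 0, d)
    (Finset.mem_product.2 ⟨hgrid 0 (Nat.zero_le m), Fintype.mem_piFinset.2 fun k =>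
      cellIndex_sub_mem_annulus hw hD (hlev k k.2)⟩)
    fun a b hab => by
      simp only [hsum] at hab
      exact Fin.ext (hcinj a (by omega) b (by omega) hab)
  simp only [hsum] at hi
  have : y i ∈ η.1 ∩ cell (w * D) (c i) := ⟨(hy i (by omega)).1, hmem i⟩
  rw [encard_eq_zero.1 hi] at this
  exact this

theorem measure_biUnion_le_ofReal {Ω ι : Type*} [MeasurableSpace Ω] {P : Measure Ω}
    {s : Finset ι} {E : ι → Set Ω} {r : ℝ} (h : ∀ i ∈ s, P (E i) ≤ ENNReal.ofReal r) :
    P (⋃ i ∈ s, E i) ≤ ENNReal.ofReal (s.card * r) := by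
  refine (measure_biUnion_finset_le s E).trans ((Finset.sum_le_card_nsmul s _ _ h).trans ?_)
  rw [nsmul_eq_mul, ENNReal.ofReal_mul (Nat.cast_nonneg _), ENNReal.ofReal_natCast]

section

variable {Ω : Type*} [MeasurableSpace Ω] {P : Measure Ω} [IsProbabilityMeasure P]
  {γ : ℝ} {X : Ω → Config}

theorem IsPoissonProcess.measure_notMem_sparseEvent_le
    (hX : IsPoissonProcess P (markedIntensity γ) X) (hγ : 0 ≤ γ) (M L : ℕ) :
    P {ω | X ω ∉ sparseEvent M L} ≤
      ENNReal.ofReal (((2 * L + 1) ^ 2 : ℕ) * (γ / M ^ 2) ^ 2) := by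
  have hsub : {ω | X ω ∉ sparseEvent M L} ⊆
      ⋃ z ∈ grid L, {ω | 1 < Config.count (cell M z) (X ω)} := by
    intro ω hω
    simpa [sparseEvent] using hω
  refine (measure_mono hsub).trans ?_
  rw [← card_grid]
  exact measure_biUnion_le_ofReal fun z _ =>
    hX.measure_one_lt_count_le (measurableSet_cell M z) (by positivity)
      (markedIntensity_cell hγ M z)

/-- Union bound over starting cells and increments. On a self-avoiding path the `m + 1` cells are
disjoint, so they are independently occupied, each with probability at most `γ / M ^ 2`. -/
theorem IsPoissonProcess.measure_notMem_noPathEvent_le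
    (hX : IsPoissonProcess P (markedIntensity γ) X) (hγ : 0 ≤ γ) {M : ℕ} (hM : 0 < M)
    (L m w j : ℕ) :
    P {ω | X ω ∉ noPathEvent M L m w j} ≤
      ENNReal.ofReal (((2 * L + 1) ^ 2 * (annulus w j).card ^ m : ℕ) * (γ / M ^ 2) ^ (m + 1)) := by
  set I := grid L ×ˢ Fintype.piFinset fun _ : Fin m => annulus w j with hI
  have hcard : I.card = (2 * L + 1) ^ 2 * (annulus w j).card ^ m := by
    rw [hI, Finset.card_product, card_grid, Fintype.card_piFinset]
    simp
  have hsub : {ω | X ω ∉ noPathEvent M L m w j} ⊆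
      ⋃ q ∈ I, {ω | Function.Injective (fun i => q.1 + Fin.partialSum q.2 i) ∧
        ∀ i, Config.count (cell M (q.1 + Fin.partialSum q.2 i)) (X ω) ≠ 0} := by
    intro ω hω
    simp only [noPathEvent, mem_ofPred_eq, not_forall, not_exists] at hω
    obtain ⟨q, hq, hinj, hne⟩ := hω
    simp only [mem_iUnion]
    exact ⟨q, hq, hinj, hne⟩
  refine (measure_mono hsub).trans ?_
  rw [← hcard]
  refine measure_biUnion_le_ofReal fun q _ => ?_
  by_cases hinj : Function.Injective (fun i => q.1 + Fin.partialSum q.2 i)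
  · refine (measure_mono fun ω hω => hω.2).trans
      ((hX.measure_forall_count_ne_zero_le (fun i => measurableSet_cell M _)
        (fun i i' h => disjoint_cell hM (hinj.ne h)) (by positivity)
        fun i => markedIntensity_cell hγ M _).trans_eq (by simp))
  · simp [hinj]

end

/-! ### The stabilization event -/

/-- The configurations with enough shields in the square of side length `3 * s`. -/
def shieldedEvent (s : ℝ) (K : ℕ) : Set Config :=
  {η | ∀ z : ℤ × ℤ, 7 * K + 8 + |(z.1 : ℝ)| ≤ 3 * s / 2 → 7 * K + 8 + |(z.2 : ℝ)| ≤ 3 * s / 2 →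
    (∃ j < K, η ∈ shieldEvent 1 (z.1 + 7 * (j : ℕ), z.2)) ∧
      ∃ j < K, η ∈ shieldEvent 0 (z.1, z.2 + 7 * (j : ℕ))}

theorem measurableSet_shieldedEvent (s : ℝ) (K : ℕ) : MeasurableSet (shieldedEvent s K) := by
  have : shieldedEvent s K = ⋂ z : ℤ × ℤ, ⋂ _ : 7 * K + 8 + |(z.1 : ℝ)| ≤ 3 * s / 2,
      ⋂ _ : 7 * K + 8 + |(z.2 : ℝ)| ≤ 3 * s / 2,
      (⋃ j : ℕ, ⋃ _ : j < K, shieldEvent 1 (z.1 + 7 * (j : ℕ), z.2)) ∩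
        ⋃ j : ℕ, ⋃ _ : j < K, shieldEvent 0 (z.1, z.2 + 7 * (j : ℕ)) := by
    ext
    simp [shieldedEvent]
  rw [this]
  exact MeasurableSet.iInter fun z => MeasurableSet.iInter fun _ => MeasurableSet.iInter fun _ =>
    (MeasurableSet.iUnion fun j => MeasurableSet.iUnion fun _ =>
      measurableSet_shieldEvent _ _).inter
    (MeasurableSet.iUnion fun j => MeasurableSet.iUnion fun _ => measurableSet_shieldEvent _ _)

theorem shielded_of_mem_shieldedEvent {s : ℝ} {K : ℕ} {η : Config} (h : η ∈ shieldedEvent s K) :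
    Shielded s K η.1 := by
  intro z h1 h2
  obtain ⟨⟨j, hj, hsh⟩, i, hi, hsh'⟩ := h z h1 h2
  exact ⟨⟨j, hj, isShield_of_mem_shieldEvent hsh⟩, i, hi, isShield_of_mem_shieldEvent hsh'⟩

theorem mem_markedBox_iff {s : ℝ} {x : MPoint} : x ∈ markedBox (3 * s) ↔ ‖x.1‖ ≤ 3 * s / 2 := by
  simp [markedBox, mem_box_iff]

theorem restrict_mem_shieldEvent_iff {s : ℝ} {m : Mark} {z : ℤ × ℤ}
    (h1 : 4 + |(z.1 : ℝ)| ≤ 3 * s / 2) (h2 : 4 + |(z.2 : ℝ)| ≤ 3 * s / 2) (η : Config) :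
    η.restrict (markedBox (3 * s)) ∈ shieldEvent m z ↔ η ∈ shieldEvent m z := by
  have hsub : window z ×ˢ (univ : Set Mark) ⊆ markedBox (3 * s) := fun x hx =>
    mem_markedBox_iff.2 (norm_le_of_mem_window h1 h2 hx.1)
  simp only [shieldEvent, mem_ofPred_eq,
    Config.count_restrict_of_subset η ((shieldCore_subset m z).trans hsub),
    Config.count_restrict_of_subset η ((shieldGap_subset m z).trans hsub)]

/-- Removing points preserves the grid events, so the grid need not fit inside the observed square.
-/
theorem restrict_mem_sparseEvent {M L : ℕ} {η : Config} (h : η ∈ sparseEvent M L)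
    (C : Set MPoint) : η.restrict C ∈ sparseEvent M L :=
  fun z hz => (η.count_restrict_le _ C).trans (h z hz)

theorem restrict_mem_noPathEvent {M L m w j : ℕ} {η : Config} (h : η ∈ noPathEvent M L m w j)
    (C : Set MPoint) : η.restrict C ∈ noPathEvent M L m w j := by
  intro q hq hinj
  obtain ⟨i, hi⟩ := h q hq hinj
  exact ⟨i, le_antisymm ((η.count_restrict_le _ C).trans hi.le) zero_le⟩

theorem disjoint_window {z z' : ℤ × ℤ} (h : 7 ≤ |z.1 - z'.1| ∨ 7 ≤ |z.2 - z'.2|) :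
    Disjoint (window z) (window z') := by
  have key : ∀ k l : ℤ, 7 ≤ |k - l| →
      Disjoint (Ico (k - 3 : ℝ) (k + 4)) (Ico (l - 3 : ℝ) (l + 4)) := by
    intro k l hkl
    rw [Set.disjoint_left]
    rintro u ⟨h1, h2⟩ ⟨h3, h4⟩
    rcases le_abs.1 hkl with h | h
    · have : (7 : ℝ) ≤ k - l := by exact_mod_cast h
      linarith
    · have : (7 : ℝ) ≤ -(k - l) := by exact_mod_cast h
      linarith
  rcases h with h | h
  · exact Disjoint.set_prod_left (key _ _ h) _ _
  · exact Disjoint.set_prod_right (key _ _ h) _ _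

section

variable {Ω : Type*} [MeasurableSpace Ω] {P : Measure Ω} [IsProbabilityMeasure P]
  {γ lam : ℝ} {X : Ω → Config}

/-- Union bound over the base points of runs and the two directions. All windows concerned lie
inside the square, so restriction does not affect them. -/
theorem IsPoissonProcess.measure_restrict_notMem_shieldedEvent_le
    (hX : IsPoissonProcess P (markedIntensity γ) X) (hlam : 0 < lam) (h1 : lam / 2 ≤ γ)
    (h2 : γ ≤ lam) {s : ℝ} {Z : ℕ} (hZ : 3 * s / 2 ≤ Z) (K : ℕ) :
    P {ω | (X ω).restrict (markedBox (3 * s)) ∉ shieldedEvent s K} ≤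
      ENNReal.ofReal (((2 * Z + 1) ^ 2 : ℕ) * (2 * (1 - shieldProb lam) ^ K)) := by
  have hsub : {ω | (X ω).restrict (markedBox (3 * s)) ∉ shieldedEvent s K} ⊆
      ⋃ z ∈ grid Z,
        ({ω | ∀ j : Fin K, X ω ∉ shieldEvent 1 (z.1 + 7 * (j : ℕ), z.2)} ∪
          {ω | ∀ j : Fin K, X ω ∉ shieldEvent 0 (z.1, z.2 + 7 * (j : ℕ))}) := by
    intro ω hω
    simp only [shieldedEvent, mem_ofPred_eq, not_forall] at hω
    obtain ⟨z, hz1, hz2, hz⟩ := hω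
    have hK : (0 : ℝ) ≤ K := K.cast_nonneg
    have hgrid : z ∈ grid Z := by
      have e1 : |(z.1 : ℝ)| ≤ Z := by linarith
      have e2 : |(z.2 : ℝ)| ≤ Z := by linarith
      exact mem_grid.2 ⟨by exact_mod_cast e1, by exact_mod_cast e2⟩
    simp only [mem_iUnion]
    refine ⟨z, hgrid, ?_⟩
    by_contra hcon
    simp only [mem_union, mem_ofPred_eq, not_or, not_forall, not_not] at hcon
    obtain ⟨⟨j, hj⟩, i, hi⟩ := hcon
    exact hz ⟨⟨j, j.2, (restrict_mem_shieldEvent_iff (z := (z.1 + 7 * (j : ℕ), z.2))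
        (run_abs_le j.2 hz1) (by simp only; linarith) _).2 hj⟩,
      i, i.2, (restrict_mem_shieldEvent_iff (z := (z.1, z.2 + 7 * (i : ℕ)))
        (by simp only; linarith) (run_abs_le i.2 hz2) _).2 hi⟩
  have hfar : ∀ {i j : Fin K} (k : ℤ), i ≠ j →
      7 ≤ |k + 7 * ((i : ℕ) : ℤ) - (k + 7 * ((j : ℕ) : ℤ))| := by
    intro i j k hij
    have : (i : ℕ) ≠ j := fun h => hij (Fin.ext h)
    rw [le_abs]
    omega
  refine (measure_mono hsub).trans ?_
  rw [← card_grid]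
  refine measure_biUnion_le_ofReal fun z _ => (measure_union_le _ _).trans ?_
  rw [ENNReal.ofReal_mul (by norm_num), ENNReal.ofReal_ofNat, two_mul]
  exact add_le_add
    (hX.measure_forall_notMem_shieldEvent_le hlam h1 h2 1
      fun i j hij => disjoint_window (Or.inl (hfar z.1 hij)))
    (hX.measure_forall_notMem_shieldEvent_le hlam h1 h2 0
      fun i j hij => disjoint_window (Or.inr (hfar z.2 hij)))

end

/-! ### Choice of parameters and error estimates -/

/-- The number of cells per unit length. -/
def mesh (C K : ℕ) : ℕ := K ^ 6 * (C * K)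

/-- A bound for the indices of the cells in the square. -/
def gridSize (C K : ℕ) : ℕ := 2 * (K + 1) ^ 5 * mesh C K

/-- The configurations for which the segments entering the square of side length `s` are not
influenced by points outside of the square of side length `3 * s`. -/
def stableEvent (C : ℕ) (s : ℝ) (K : ℕ) : Set Config :=
  shieldedEvent s K ∩ (sparseEvent (mesh C K) (gridSize C K) ∩
    ⋂ j ∈ Finset.range ((7 * K + 1) * (C * K) + 1),
      noPathEvent (mesh C K) (gridSize C K) K (K ^ 6) j)

theorem measurableSet_stableEvent (C : ℕ) (s : ℝ) (K : ℕ) : MeasurableSet (stableEvent C s K) :=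
  (measurableSet_shieldedEvent s K).inter ((measurableSet_sparseEvent _ _).inter
    (Finset.measurableSet_biInter _ fun _ _ => measurableSet_noPathEvent _ _ _ _ _))

theorem entering_eq_of_mem_stableEvent {C K : ℕ} (hC : 0 < C) (hK : 512 * C ≤ K) {s : ℝ}
    (hs1 : (K : ℝ) ^ 5 ≤ s) (hs2 : s ≤ (K + 1 : ℝ) ^ 5) {φ : Config} (hφ : Admissible φ.1)
    (hmem : φ.restrict (markedBox (3 * s)) ∈ stableEvent C s K) {ψ : Set MPoint}
    (hψ : ψ ⊆ (markedBox (3 * s))ᶜ) (hφψ : Admissible (φ.1 ∪ ψ)) :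
    entering s φ.1 = entering s (φ.1 ∪ ψ) := by
  obtain ⟨hsh, hsp, hpath⟩ := hmem
  have hC' : (1 : ℝ) ≤ C := by exact_mod_cast hC
  have hK' : 512 * (C : ℝ) ≤ K := by exact_mod_cast hK
  have hK1 : (512 : ℝ) ≤ K := by linarith
  have hK0 : 0 < K := by omega
  have hs0 : 0 ≤ s := le_trans (by positivity) hs1
  have hK4 : (1 : ℝ) ≤ (K : ℝ) ^ 4 := one_le_pow₀ (by linarith)
  have hK3 : (512 : ℝ) ≤ (K : ℝ) ^ 4 := by
    calc (512 : ℝ) ≤ K := hK1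
      _ ≤ (K : ℝ) ^ 4 := le_self_pow₀ (by linarith) (by norm_num)
  have hw : 0 < K ^ 6 := by positivity
  have hD : 0 < C * K := by positivity
  have hM : (1 : ℝ) ≤ (K ^ 6 * (C * K) : ℕ) := by exact_mod_cast Nat.mul_pos hw hD
  refine entering_eq hφ hφψ (K := K) (D := C * K) (m := K) ?_ ?_ ?_ ?_ ?_
  · nlinarith
  · push_cast
    have h1 : (7 * (K : ℝ) + 1) ≤ 8 * K := by linarith
    have h2 : (7 * (K : ℝ) + 1) * (C * K) + 1 ≤ 16 * C * K ^ 2 := by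
      have : (1 : ℝ) ≤ C * K := by nlinarith
      nlinarith
    -- The total length of a chain is at most `128 * C * K ^ 4`; the condition `512 * C ≤ K` turns
    -- this into `K ^ 5 / 4`.
    calc ((7 * (K : ℝ) + 1) * (C * K) + 1) * K * (7 * K + 1)
        ≤ (16 * C * K ^ 2) * K * (8 * K) := by gcongr
      _ = (512 * C) * K ^ 4 / 4 := by ring
      _ ≤ K * K ^ 4 / 4 := by gcongr
      _ = K ^ 5 / 4 := by ring
      _ ≤ s / 4 := by gcongr
  · intro x hx
    refine ⟨Or.inl, ?_⟩
    rintro (h | h)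
    · exact h
    · exact absurd (mem_markedBox_iff.2 hx) (hψ h)
  · refine (shielded_of_mem_shieldedEvent hsh).congr fun x hx => ⟨fun h => h.1, fun h => ?_⟩
    exact ⟨h, mem_markedBox_iff.2 hx⟩
  · intro j hj hchain
    have hL : 5 * s / 4 * (K ^ 6 * (C * K) : ℕ) + 1 ≤ (gridSize C K : ℕ) := by
      have e : ((gridSize C K : ℕ) : ℝ) = 2 * (K + 1 : ℝ) ^ 5 * (K ^ 6 * (C * K) : ℕ) := by
        simp [gridSize, mesh]
      have h2 : (2 : ℝ) ≤ s := by nlinarith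
      rw [e]
      nlinarith
    refine not_hasLevelChain hw hD hL hsp (mem_iInter₂.1 hpath j (by simp; omega)) ?_
    obtain ⟨y, hy, hinj, hlev⟩ := hchain
    refine ⟨y, fun i hi => ⟨⟨(hy i hi).1, mem_markedBox_iff.2 ?_⟩, (hy i hi).2⟩, hinj, hlev⟩
    linarith [(hy i hi).2]

/-- A bound for the probability of the complement of the stabilization event. -/
noncomputable def errorBound (lam : ℝ) (C K : ℕ) : ℝ :=
  51200 * (K ^ 10 * (1 - shieldProb lam) ^ K) + 16641 * lam ^ 2 * (1 / K) +
    266256 * C * lam * (K ^ 12 * (1 / 2) ^ K)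

/-- The three terms account for a run without shield, a crowded cell and an occupied path. -/
theorem tendsto_errorBound {lam : ℝ} (hlam : 0 < lam) (C : ℕ) :
    Tendsto (errorBound lam C) atTop (𝓝 0) := by
  have hp := shieldProb_pos hlam
  have hp1 := shieldProb_le_one lam
  have t1 : Tendsto (fun K : ℕ => (K : ℝ) ^ 10 * (1 - shieldProb lam) ^ K) atTop (𝓝 0) :=
    tendsto_pow_const_mul_const_pow_of_abs_lt_one 10 (by rw [abs_lt]; constructor <;> linarith)
  have t2 : Tendsto (fun K : ℕ => 1 / (K : ℝ)) atTop (𝓝 0) := tendsto_one_div_atTop_nhds_zero_nat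
  have t3 : Tendsto (fun K : ℕ => (K : ℝ) ^ 12 * (1 / 2 : ℝ) ^ K) atTop (𝓝 0) :=
    tendsto_pow_const_mul_const_pow_of_abs_lt_one 12 (by rw [abs_lt]; constructor <;> norm_num)
  have h := ((t1.const_mul 51200).add (t2.const_mul (16641 * lam ^ 2))).add
    (t3.const_mul (266256 * C * lam))
  simp only [mul_zero, add_zero] at h
  exact h

theorem add_one_pow_five_le {K : ℕ} (hK : 1 ≤ K) : (K + 1 : ℝ) ^ 5 ≤ 32 * (K : ℝ) ^ 5 := by
  have hK' : (1 : ℝ) ≤ K := by exact_mod_cast hK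
  calc (K + 1 : ℝ) ^ 5 ≤ (2 * K) ^ 5 := by gcongr; linarith
    _ = 32 * (K : ℝ) ^ 5 := by ring

theorem two_mul_gridSize_add_one_sq_le {C K : ℕ} (hC : 1 ≤ C) (hK : 1 ≤ K) :
    (2 * (gridSize C K : ℝ) + 1) ^ 2 ≤ 16641 * (K : ℝ) ^ 10 * (mesh C K : ℝ) ^ 2 := by
  have hK' : (1 : ℝ) ≤ K := by exact_mod_cast hK
  have hM : (1 : ℝ) ≤ mesh C K := by
    have : 1 ≤ mesh C K := Nat.one_le_iff_ne_zero.2 (by unfold mesh; positivity)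
    exact_mod_cast this
  have h5 : (1 : ℝ) ≤ (K : ℝ) ^ 5 := one_le_pow₀ hK'
  have h1 : 2 * (gridSize C K : ℝ) + 1 ≤ 129 * (K : ℝ) ^ 5 * mesh C K := by
    have e : (gridSize C K : ℝ) = 2 * (K + 1 : ℝ) ^ 5 * mesh C K := by simp [gridSize]
    have h2 : (K + 1 : ℝ) ^ 5 * mesh C K ≤ 32 * (K : ℝ) ^ 5 * mesh C K :=
      mul_le_mul_of_nonneg_right (add_one_pow_five_le hK) (by linarith)
    have h3 : 1 ≤ (K : ℝ) ^ 5 * mesh C K := one_le_mul_of_one_le_of_one_le h5 hM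
    rw [e]
    linarith
  calc (2 * (gridSize C K : ℝ) + 1) ^ 2 ≤ (129 * (K : ℝ) ^ 5 * mesh C K) ^ 2 := by gcongr
    _ = _ := by ring

/-- Each further step of a path costs a factor at most `1 / 2`: with `w = K ^ 6` and `D = C * K`,
the annulus has at most `544 * K * D * w ^ 2` cells, which gives `544 * lam / C`. -/
theorem card_annulus_mul_le {C K j : ℕ} {lam : ℝ} (hlam : 0 ≤ lam) (hC : 1088 * lam ≤ C)
    (hC1 : 1 ≤ C) (hK : 2 ≤ K) (hj : j ≤ (7 * K + 1) * (C * K)) :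
    ((annulus (K ^ 6) j).card : ℝ) * (lam / (mesh C K : ℝ) ^ 2) ≤ 1 / 2 := by
  have hK' : (2 : ℝ) ≤ K := by exact_mod_cast hK
  have hC' : (1 : ℝ) ≤ C := by exact_mod_cast hC1
  have hcard : ((annulus (K ^ 6) j).card : ℝ) ≤
      ((K : ℝ) ^ 6 + 3) * (8 * ((j + 1) * (K : ℝ) ^ 6 + 1) + 1) := by
    exact_mod_cast card_annulus_le (K ^ 6) j
  have hj' : (j : ℝ) ≤ (7 * K + 1) * (C * K) := by exact_mod_cast hj
  set w : ℝ := (K : ℝ) ^ 6 with hw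
  have hw3 : 3 ≤ w := by
    calc (3 : ℝ) ≤ 2 ^ 6 := by norm_num
      _ ≤ w := by rw [hw]; gcongr
  set D : ℝ := C * K with hD
  have hD1 : 1 ≤ D := by nlinarith
  have hj1 : (j : ℝ) + 1 ≤ 16 * K * D := by nlinarith
  have h1 : (1 : ℝ) ≤ (j + 1) * w := by nlinarith [(Nat.cast_nonneg j : (0 : ℝ) ≤ j)]
  have h2 : ((annulus (K ^ 6) j).card : ℝ) ≤ 544 * K * D * w ^ 2 := by
    calc ((annulus (K ^ 6) j).card : ℝ) ≤ (w + 3) * (8 * ((j + 1) * w + 1) + 1) := hcard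
      _ ≤ (2 * w) * (17 * ((j + 1) * w)) := by
        refine mul_le_mul (by linarith) (by linarith) (by positivity) (by positivity)
      _ ≤ (2 * w) * (17 * ((16 * K * D) * w)) := by gcongr
      _ = 544 * K * D * w ^ 2 := by ring
  have hM : (mesh C K : ℝ) = w * D := by simp [mesh, hw, hD]
  rw [hM, ← mul_div_assoc, div_le_iff₀ (by positivity)]
  calc ((annulus (K ^ 6) j).card : ℝ) * lam ≤ 544 * K * D * w ^ 2 * lam := by gcongr
    _ = (1088 * lam) * K * (D * w ^ 2) / 2 := by ring
    _ ≤ C * K * (D * w ^ 2) / 2 := by gcongr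
    _ = 1 / 2 * (w * D) ^ 2 := by rw [hD]; ring

section

variable {Ω : Type*} [MeasurableSpace Ω] {P : Measure Ω} [IsProbabilityMeasure P]
  {γ lam : ℝ} {X : Ω → Config}

theorem IsPoissonProcess.measure_restrict_notMem_stableEvent_le
    (hX : IsPoissonProcess P (markedIntensity γ) X) (hlam : 0 < lam) (h1 : lam / 2 ≤ γ)
    (h2 : γ ≤ lam) {C K : ℕ} (hC : 1088 * lam ≤ C) (hC1 : 1 ≤ C) (hK : 2 ≤ K) {s : ℝ}
    (hs : s ≤ (K + 1 : ℝ) ^ 5) :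
    P {ω | (X ω).restrict (markedBox (3 * s)) ∉ stableEvent C s K} ≤
      ENNReal.ofReal (errorBound lam C K) := by
  have hγ : 0 ≤ γ := by linarith
  have hK' : (2 : ℝ) ≤ K := by exact_mod_cast hK
  have hC' : (1 : ℝ) ≤ C := by exact_mod_cast hC1
  set M := mesh C K with hMdef
  set L := gridSize C K with hLdef
  set J := (7 * K + 1) * (C * K) with hJ
  have hM0 : 0 < M := by rw [hMdef, mesh]; positivity
  have hM0' : (0 : ℝ) < M := by exact_mod_cast hM0
  have hp1 := shieldProb_le_one lam
  have hsub : {ω | (X ω).restrict (markedBox (3 * s)) ∉ stableEvent C s K} ⊆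
      {ω | (X ω).restrict (markedBox (3 * s)) ∉ shieldedEvent s K} ∪
        {ω | X ω ∉ sparseEvent M L} ∪
        ⋃ j ∈ Finset.range (J + 1), {ω | X ω ∉ noPathEvent M L K (K ^ 6) j} := by
    intro ω hω
    by_contra hcon
    simp only [mem_union, mem_ofPred_eq, mem_iUnion, not_or, not_not, not_exists] at hcon
    obtain ⟨⟨c1, c2⟩, c3⟩ := hcon
    exact hω ⟨c1, restrict_mem_sparseEvent c2 _, mem_iInter₂.2 fun j hj =>
      restrict_mem_noPathEvent (c3 j hj) _⟩
  have b1 := hX.measure_restrict_notMem_shieldedEvent_le hlam h1 h2 (s := s)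
    (Z := 2 * (K + 1) ^ 5) (by
      push_cast
      have : (0 : ℝ) ≤ (K + 1 : ℝ) ^ 5 := by positivity
      linarith) K
  have b2 := hX.measure_notMem_sparseEvent_le hγ M L
  have hLM := two_mul_gridSize_add_one_sq_le hC1 (by omega : 1 ≤ K)
  rw [← hMdef, ← hLdef] at hLM
  have hdiv : γ / (M : ℝ) ^ 2 ≤ lam / (M : ℝ) ^ 2 := by gcongr
  have b3 : ∀ j ∈ Finset.range (J + 1), P {ω | X ω ∉ noPathEvent M L K (K ^ 6) j} ≤
      ENNReal.ofReal (16641 * lam * ((K : ℝ) ^ 10 * (1 / 2) ^ K)) := by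
    intro j hj
    refine (hX.measure_notMem_noPathEvent_le hγ hM0 L K (K ^ 6) j).trans
      (ENNReal.ofReal_le_ofReal ?_)
    push_cast
    have hA := card_annulus_mul_le hlam.le hC hC1 hK (Nat.lt_succ_iff.1 (Finset.mem_range.1 hj))
    rw [← hMdef] at hA
    set A : ℝ := ((annulus (K ^ 6) j).card : ℝ)
    have hA0 : 0 ≤ A := Nat.cast_nonneg _
    -- A path has one more cell than steps. The additional factor `lam / M ^ 2` cancels the `M ^ 2`
    -- in the number of starting cells.
    calc (2 * (L : ℝ) + 1) ^ 2 * A ^ K * (γ / M ^ 2) ^ (K + 1)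
        ≤ (2 * (L : ℝ) + 1) ^ 2 * A ^ K * (lam / M ^ 2) ^ (K + 1) := by gcongr
      _ = (2 * (L : ℝ) + 1) ^ 2 * (A * (lam / M ^ 2)) ^ K * (lam / M ^ 2) := by ring
      _ ≤ (16641 * (K : ℝ) ^ 10 * M ^ 2) * (1 / 2) ^ K * (lam / M ^ 2) := by gcongr
      _ = 16641 * lam * ((K : ℝ) ^ 10 * (1 / 2) ^ K) := by field_simp
  have b3' := measure_biUnion_le_ofReal b3
  refine (measure_mono hsub).trans ((measure_union_le _ _).trans
    ((add_le_add ((measure_union_le _ _).trans (add_le_add b1 b2)) b3').trans ?_))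
  have hq : 0 ≤ (1 - shieldProb lam) ^ K := pow_nonneg (by linarith) K
  rw [← ENNReal.ofReal_add (by positivity) (by positivity),
    ← ENNReal.ofReal_add (by positivity) (by positivity)]
  refine ENNReal.ofReal_le_ofReal ?_
  unfold errorBound
  refine add_le_add (add_le_add ?_ ?_) ?_
  · push_cast
    have h5 := add_one_pow_five_le (by omega : 1 ≤ K)
    have h6 : (1 : ℝ) ≤ (K : ℝ) ^ 5 := one_le_pow₀ (by linarith)
    have h7 : 2 * (2 * (K + 1 : ℝ) ^ 5) + 1 ≤ 160 * (K : ℝ) ^ 5 := by linarith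
    calc (2 * (2 * (K + 1 : ℝ) ^ 5) + 1) ^ 2 * (2 * (1 - shieldProb lam) ^ K)
        ≤ (160 * (K : ℝ) ^ 5) ^ 2 * (2 * (1 - shieldProb lam) ^ K) := by gcongr
      _ = 51200 * (K ^ 10 * (1 - shieldProb lam) ^ K) := by ring
  · push_cast
    have hMK : (K : ℝ) ^ 7 ≤ M := by
      have e : (M : ℝ) = C * (K : ℝ) ^ 7 := by
        rw [hMdef]; simp only [mesh]; push_cast; ring
      rw [e]
      exact le_mul_of_one_le_left (by positivity) hC'
    have hK11 : (K : ℝ) ^ 11 ≤ M ^ 2 := by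
      calc (K : ℝ) ^ 11 ≤ (K : ℝ) ^ 14 := pow_le_pow_right₀ (by linarith) (by norm_num)
        _ = ((K : ℝ) ^ 7) ^ 2 := by ring
        _ ≤ M ^ 2 := by gcongr
    calc (2 * (L : ℝ) + 1) ^ 2 * (γ / M ^ 2) ^ 2
        ≤ (16641 * (K : ℝ) ^ 10 * M ^ 2) * (lam / M ^ 2) ^ 2 := by gcongr
      _ = 16641 * lam ^ 2 * (K ^ 10 / M ^ 2) := by field_simp
      _ ≤ 16641 * lam ^ 2 * (1 / K) := by
        gcongr 16641 * lam ^ 2 * ?_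
        rw [div_le_div_iff₀ (by positivity) (by positivity)]
        linarith [(by ring : (K : ℝ) ^ 10 * K = (K : ℝ) ^ 11)]
  · rw [Finset.card_range]
    have hJ' : ((J + 1 : ℕ) : ℝ) ≤ 16 * C * K ^ 2 := by
      rw [hJ]
      push_cast
      have : (1 : ℝ) ≤ C * K := by nlinarith
      nlinarith
    calc ((J + 1 : ℕ) : ℝ) * (16641 * lam * ((K : ℝ) ^ 10 * (1 / 2) ^ K))
        ≤ (16 * C * K ^ 2) * (16641 * lam * ((K : ℝ) ^ 10 * (1 / 2) ^ K)) := by gcongr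
      _ = 266256 * C * lam * (K ^ 12 * (1 / 2) ^ K) := by ring

end

/-- The number of windows in a run. -/
noncomputable def runLength (s : ℝ) : ℕ := ⌊s ^ (1 / 5 : ℝ)⌋₊

theorem tendsto_runLength : Tendsto runLength atTop atTop :=
  tendsto_nat_floor_atTop.comp (tendsto_rpow_atTop (by norm_num))

theorem runLength_pow_le {s : ℝ} (hs : 0 ≤ s) :
    (runLength s : ℝ) ^ 5 ≤ s ∧ s ≤ (runLength s + 1 : ℝ) ^ 5 := by
  have h0 : 0 ≤ s ^ (1 / 5 : ℝ) := Real.rpow_nonneg hs _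
  have e : (s ^ (1 / 5 : ℝ)) ^ 5 = s := by
    rw [← Real.rpow_natCast, ← Real.rpow_mul hs]
    norm_num
  constructor
  · calc (runLength s : ℝ) ^ 5 ≤ (s ^ (1 / 5 : ℝ)) ^ 5 := by
          gcongr; exact Nat.floor_le h0
      _ = s := e
  · calc s = (s ^ (1 / 5 : ℝ)) ^ 5 := e.symm
      _ ≤ (runLength s + 1 : ℝ) ^ 5 := by
          gcongr; exact (Nat.lt_floor_add_one _).le

/-- Makes all estimates uniform over the varying intensities. -/
theorem intensity_bounds {lam s : ℝ} (hlam : 0 < lam) (hs : 2 ≤ s) :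
    lam / 2 ≤ lam * (1 - 1 / s ^ 3) ∧ lam * (1 - 1 / s ^ 3) ≤ lam := by
  have h1 : 1 / s ^ 3 ≤ 1 / 2 := by
    refine one_div_le_one_div_of_le (by norm_num) (hs.trans ?_)
    exact le_self_pow₀ (by linarith) (by norm_num)
  have h2 : 0 ≤ 1 / s ^ 3 := by positivity
  constructor <;> nlinarith

end Lilypond

theorem mainTheorem8 {Ω : Type*} [MeasurableSpace Ω] (P : Measure Ω) [IsProbabilityMeasure P]
    (lam : ℝ) (hlam : 0 < lam) (X : ℝ → Ω → Lilypond.Config)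
    (hX : ∀ s : ℝ, 1 < s →
      Lilypond.IsPoissonProcess P (Lilypond.markedIntensity (lam * (1 - 1 / s ^ 3))) (X s)) :
    ∃ A : ℝ → Set Lilypond.Config,
      (∀ s : ℝ, 1 ≤ s → MeasurableSet (A s)) ∧
      Tendsto (fun s : ℝ => P {ω | (X s ω).restrict (Lilypond.markedBox (3 * s)) ∈ A s})
        atTop (𝓝 1) ∧
      ∀ s : ℝ, 1 ≤ s → ∀ φ : Lilypond.Config, Lilypond.Admissible φ.1 →
        φ.restrict (Lilypond.markedBox (3 * s)) ∈ A s →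
        ∀ ψ : Set Lilypond.MPoint, Lilypond.LocallyFinite ψ →
          ψ ⊆ (Lilypond.markedBox (3 * s))ᶜ → Lilypond.Admissible (φ.1 ∪ ψ) →
          Lilypond.entering s φ.1 = Lilypond.entering s (φ.1 ∪ ψ) := by
  set C : ℕ := ⌈1088 * lam⌉₊ + 1 with hCdef
  have hC : 1088 * lam ≤ C := (Nat.le_ceil _).trans (by rw [hCdef]; push_cast; linarith)
  have hC1 : 1 ≤ C := by omega
  -- While `runLength s` is too small the event is empty, so the deterministic claim is vacuous
  -- there and the limit is unaffected.
  refine ⟨fun s => {η | 512 * C ≤ Lilypond.runLength s ∧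
    η ∈ Lilypond.stableEvent C s (Lilypond.runLength s)}, fun s _ => ?_, ?_, ?_⟩
  · exact (MeasurableSet.const _).inter (Lilypond.measurableSet_stableEvent C s _)
  · have hlim : Tendsto (fun s => 1 - ENNReal.ofReal
        (Lilypond.errorBound lam C (Lilypond.runLength s))) atTop (𝓝 1) := by
      have h1 := ENNReal.tendsto_ofReal
        ((Lilypond.tendsto_errorBound hlam C).comp Lilypond.tendsto_runLength)
      have h2 := ENNReal.Tendsto.sub (tendsto_const_nhds (x := (1 : ℝ≥0∞))) h1
        (Or.inl ENNReal.one_ne_top)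
      simpa using h2
    refine tendsto_of_tendsto_of_tendsto_of_le_of_le' hlim tendsto_const_nhds ?_
      (Eventually.of_forall fun s => prob_le_one)
    filter_upwards [eventually_ge_atTop 2,
      Lilypond.tendsto_runLength.eventually_ge_atTop (512 * C)] with s hs2 hsK
    obtain ⟨g1, g2⟩ := Lilypond.intensity_bounds hlam hs2
    have hbad := (hX s (by linarith)).measure_restrict_notMem_stableEvent_le hlam g1 g2 hC hC1
      (K := Lilypond.runLength s) (by omega) (Lilypond.runLength_pow_le (by linarith)).2
    rw [tsub_le_iff_right]
    refine le_trans ?_ (add_le_add_right hbad _)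
    -- Covering the whole space by the good and the bad event gives the lower bound by
    -- subadditivity, without measurability of either.
    rw [← measure_univ (μ := P)]
    refine (measure_mono fun ω _ => ?_).trans (measure_union_le _ _)
    by_cases h : (X s ω).restrict (Lilypond.markedBox (3 * s)) ∈
        Lilypond.stableEvent C s (Lilypond.runLength s)
    · exact Or.inl ⟨hsK, h⟩
    · exact Or.inr h
  · intro s hs φ hφ hmem ψ _ hψ hφψ
    obtain ⟨h1, h2⟩ := Lilypond.runLength_pow_le (by linarith : 0 ≤ s)
    exact Lilypond.entering_eq_of_mem_stableEvent hC1 hmem.1 h1 h2 hφ hmem.2 hψ hφψ
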